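/- Let $\mathcal X$ be a real Banach space with dual $\mathcal X^*$ and bidual $\mathcal X^{**}$. Assume that $\mathcal X^*$ is separable and of type 2, i.e. there is $b>0$ such that $E\|\sum_{i=1}^n U_i\|^2\le b\sum_{i=1}^n E\|U_i\|^2$ for all $n\ge 1$ and all independent zero-mean random elements $U_1,\dots,U_n$ of $\mathcal X^*$ with $E\|U_i\|^2<\infty$. Assume also that the norm of $\mathcal X$ is twice Gâteaux differentiable at every $x\neq 0$. For $x\ne 0$ let $\mathrm{SGN}_x\in\mathcal X^*$ be the Gâteaux derivative of the norm at $x$, and put $\mathrm{SGN}_0=0$. Let $P$ be a nonatomic Borel probability measure on $\mathcal X$ and let $X,Z$ be independent with law $P$. Assume that the Hessian $J_0:\mathcal X\to\mathcal X^*$ at $0$ of $x\mapsto E\|Z-X+x\|$ exists, in the sense that for every $h\in\mathcal X$ $$E(\mathrm{SGN}_{Z-X+th})=E(\mathrm{SGN}_{Z-X})+t\,J_0(h)+R(t),\qquad \|R(t)\|/t\to 0\ \text{ as } t\to 0 .$$ Put $\mu=E(\mathrm{SGN}_{Z-X})$ and, for $f,g\in\mathcal X^{**}$, $$\Gamma_1(f,g)=E\big[f\{E(\mathrm{SGN}_{Z-X}\mid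 X)\}\,g\{E(\mathrm{SGN}_{Z-X}\mid X)\}\big]-f(\mu)g(\mu).$$ Fix a nonzero $\delta\in\mathcal X$. For $m,n\ge1$ and $N=m+n$ let $X_1,\dots,X_m,Y_1,\dots,Y_n$ be independent, each $X_i$ with law $P$ and each $Y_j$ distributed as $X+\Delta_N$, where $\Delta_N=\delta\,(mn/N)^{-1/2}$, and let $$T_{WMW}=\frac1{mn}\sum_{i=1}^m\sum_{j=1}^n \mathrm{SGN}_{Y_j-X_i}.$$ If $m,n\to\infty$ with $m/N\to\gamma\in(0,1)$, then $(mn/N)^{1/2}\,T_{WMW}$ converges weakly in $\mathcal X^*$ to the Gaussian law $G\{J_0(\delta),\Gamma_1\}$ with mean $J_0(\delta)$ and covariance $\Gamma_1$. -/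

import Mathlib

open Set Filter Topology MeasureTheory ProbabilityTheory

noncomputable section

namespace WMW

universe u

/-- `L` is the Gâteaux derivative of the real function `f` at `x`: for every direction `h`,
`t⁻¹ (f (x + t h) - f x)` tends to `L h` as `t → 0`. -/
def HasGateauxDerivAt {E : Type u} [NormedAddCommGroup E] [NormedSpace ℝ E]
    (f : E → ℝ) (L : StrongDual ℝ E) (x : E) : Prop :=
  ∀ h : E, HasLineDerivAt ℝ f (L h) x h

/-- `f` is twice Gâteaux differentiable at `x`: it has a Gâteaux derivative `D y` at every `y`
near `x`, and there is a bounded bilinear form `T` such that, for all directions `h`, `k`,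
`t⁻¹ (D (x + t h) k - D x k)` tends to `T h k` as `t → 0`. -/
def TwiceGateauxDifferentiableAt {E : Type u} [NormedAddCommGroup E] [NormedSpace ℝ E]
    (f : E → ℝ) (x : E) : Prop :=
  ∃ D : E → StrongDual ℝ E, (∀ᶠ y in 𝓝 x, HasGateauxDerivAt f (D y) y) ∧
    ∃ T : E →L[ℝ] StrongDual ℝ E, ∀ h k : E, HasLineDerivAt ℝ (fun y => D y k) (T h k) x h

open Classical in
/-- The sign `SGN_x`: the Gâteaux derivative of the norm at `x ≠ 0`, and `0` at `x = 0`.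
(At a point `x ≠ 0` where the norm is not Gâteaux differentiable the value is the dummy `0`.) -/
def SGN {E : Type u} [NormedAddCommGroup E] [NormedSpace ℝ E] (x : E) : StrongDual ℝ E :=
  if h : x ≠ 0 ∧ ∃ L : StrongDual ℝ E, HasGateauxDerivAt (fun y : E => ‖y‖) L x then
    h.2.choose
  else 0

/-- A Banach space `E` is of type 2. The probability spaces range over the universe of `E`,
which contains every finite product `Fin n → E`, hence every joint law that can occur. -/
def IsTypeTwo (E : Type u) [NormedAddCommGroup E] [NormedSpace ℝ E] [MeasurableSpace E]
    [BorelSpace E] : Prop :=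
  ∃ b : ℝ, 0 < b ∧
    ∀ (n : ℕ) (Ω : Type u) [MeasurableSpace Ω] (μ : Measure Ω) [IsProbabilityMeasure μ]
      (U : Fin n → Ω → E),
      (∀ i, Measurable (U i)) → (∀ i, MemLp (U i) 2 μ) → iIndepFun U μ →
      (∀ i, ∫ ω, U i ω ∂μ = 0) →
      ∫ ω, ‖∑ i, U i ω‖ ^ 2 ∂μ ≤ b * ∑ i, ∫ ω, ‖U i ω‖ ^ 2 ∂μ

/-- `ν` is the Gaussian law with mean `m` and covariance `C`. -/
def IsGaussianWith {E : Type u} [NormedAddCommGroup E] [NormedSpace ℝ E] [MeasurableSpace E]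
    (ν : Measure E) (m : E) (C : StrongDual ℝ E → StrongDual ℝ E → ℝ) : Prop :=
  IsGaussian ν ∧ (∀ l : StrongDual ℝ E, ∫ w, l w ∂ν = l m) ∧
    ∀ l l' : StrongDual ℝ E, cov[fun w => l w, fun w => l' w; ν] = C l l'

section

variable {E : Type u} [NormedAddCommGroup E] [NormedSpace ℝ E] [MeasurableSpace E]

/-- `E (SGN_{Y - X + z})` (Bochner integral) for independent `X ∼ P`, `Y ∼ Q`. -/
def meanSGN (P Q : Measure E) (z : E) : StrongDual ℝ E :=
  ∫ p : E × E, SGN (p.2 - p.1 + z) ∂(P.prod Q)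

/-- `J` is the Hessian `J_x` of `z ↦ E ‖Y - X + z‖` at `x`, for independent `X ∼ P`, `Y ∼ Q`:
for every `h`, `E (SGN_{Y - X + x + t h}) = E (SGN_{Y - X + x}) + t J(h) + R(t)` with
`‖R(t)‖ / t → 0` as `t → 0`. -/
def IsHessianAt (P Q : Measure E) (J : E → StrongDual ℝ E) (x : E) : Prop :=
  ∀ h : E, HasLineDerivAt ℝ (meanSGN P Q) (J h) x h

/-- The conditional expectation `E (SGN_{Y - X} ∣ X)` for independent `X ∼ P`, `Y ∼ Q`, where
`X` and `Y` are the two coordinates of the product space. -/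
def condSGN (P Q : Measure E) : E × E → StrongDual ℝ E :=
  (P.prod Q)[fun p : E × E => SGN (p.2 - p.1) |
    MeasurableSpace.comap (Prod.fst : E × E → E) inferInstance]

/-- The covariance functional `Γ₁` on the bidual. -/
def Gamma₁ (P Q : Measure E) (f g : StrongDual ℝ (StrongDual ℝ E)) : ℝ :=
  (∫ p, f (condSGN P Q p) * g (condSGN P Q p) ∂(P.prod Q)) - f (meanSGN P Q 0) * g (meanSGN P Q 0)

end

/-- The Wilcoxon–Mann–Whitney statistic of the samples `x₁, …, x_m` and `y₁, …, y_n`. -/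
def statistic {E : Type u} [NormedAddCommGroup E] [NormedSpace ℝ E] {m n : ℕ}
    (x : Fin m → E) (y : Fin n → E) : StrongDual ℝ E :=
  ((m : ℝ) * n)⁻¹ • ∑ i, ∑ j, SGN (y j - x i)

/-- The normalizing factor `(mn/N)^{1/2}`, where `N = m + n`. -/
def rate (m n : ℕ) : ℝ := √((m : ℝ) * n / ((m : ℝ) + n))

end WMW

end

namespace WMW

universe u

/-! Writing each `Y_j` as a shift of an element with law `P` turns the statistic into an average of
the kernel `SGN (z - x + t k • δ)`, `t k = (rate (m k) (n k))⁻¹`, over two independent i.i.d.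
sequences with law `P`. The samples no longer depend on the shift; only the kernel varies with `k`.
The Hoeffding decomposition (`rate_smul_sum_eq`) then splits the normalized statistic into a
deterministic mean, two normalized sums of projections and a completely degenerate remainder.

The sign is odd, so its mean at shift `0` vanishes. Hence `rate` times the mean is a difference
quotient of `meanSGN` with step `t k`, and it tends to `J₀ δ`. For the remainder, type 2 used once
in each variable bounds the second moment of the double sum by a constant times `m * n`, and the
normalization makes this `O(1 / (m + n))`.

The projections converge pointwise to `g` and `-g`, where `g x` is the mean of `SGN (Z - x)`: the
sign is norm continuous along lines through nonzero points (`tendsto_SGN_add_smul`), and `P` has no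
atoms. By type 2, replacing the projections by their limits costs nothing in mean square.

What is left is `√(1 - γ)` times a normalized sum of `g` minus `√γ` times an independent copy. The
central limit theorem in type 2 spaces (`exists_tendsto_map_normSum`) comes from tightness and the
real central limit theorem for each functional. The squared weights add up to `1`, so the limit has
covariance `E (f (g X) * f' (g X))`, which is `Γ₁` because the mean of the sign is `0`. -/

/-- The inequality of type 2 with the constant `b`. -/
def HasTypeTwoConst (E : Type u) [NormedAddCommGroup E] [NormedSpace ℝ E] [MeasurableSpace E]
    (b : ℝ) : Prop :=
  0 < b ∧
    ∀ (n : ℕ) (Ω : Type u) [MeasurableSpace Ω] (μ : Measure Ω) [IsProbabilityMeasure μ]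
      (U : Fin n → Ω → E),
      (∀ i, Measurable (U i)) → (∀ i, MemLp (U i) 2 μ) → iIndepFun U μ →
      (∀ i, ∫ ω, U i ω ∂μ = 0) →
      ∫ ω, ‖∑ i, U i ω‖ ^ 2 ∂μ ≤ b * ∑ i, ∫ ω, ‖U i ω‖ ^ 2 ∂μ

lemma integrable_norm_sq_of_bound {B α : Type*} [NormedAddCommGroup B]
    [MeasurableSpace B] [BorelSpace B] [MeasurableSpace α] {μ : Measure α}
    [IsFiniteMeasure μ] {f : α → B} (hf : Measurable f) {C : ℝ} (hC : ∀ x, ‖f x‖ ≤ C) :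
    Integrable (fun x => ‖f x‖ ^ 2) μ := by
  refine Integrable.of_bound (hf.norm.pow_const 2).aestronglyMeasurable (C ^ 2) (ae_of_all _ fun x => ?_)
  rw [Real.norm_of_nonneg (by positivity)]
  have := hC x
  gcongr

/-! ### Second moment bounds from type 2. -/

section TypeTwo

variable {B : Type u} [NormedAddCommGroup B] [NormedSpace ℝ B] [MeasurableSpace B] [BorelSpace B]
  [SecondCountableTopology B] {S : Type u} [MeasurableSpace S]

/-- The inequality of type 2 for sums of functions of the coordinates of an i.i.d. sequence. -/
lemma HasTypeTwoConst.integral_norm_sum_sq_le {b : ℝ} (hb : HasTypeTwoConst B b)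
    (P : Measure S) [IsProbabilityMeasure P] {U : S → B} (hU : Measurable U) {C : ℝ}
    (hC : ∀ x, ‖U x‖ ≤ C) (h0 : ∫ x, U x ∂P = 0) (m : ℕ) :
    ∫ ξ, ‖∑ i ∈ Finset.range m, U (ξ i)‖ ^ 2 ∂(Measure.infinitePi fun _ : ℕ => P) ≤
      b * (m * ∫ x, ‖U x‖ ^ 2 ∂P) := by
  set ρ := Measure.infinitePi fun _ : ℕ => P with hρ
  have hmp (i : ℕ) : MeasurePreserving (fun ξ : ℕ → S => ξ i) ρ P :=
    measurePreserving_eval_infinitePi (fun _ => P) i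
  have hind : iIndepFun (fun (i : ℕ) (ξ : ℕ → S) => U (ξ i)) ρ :=
    iIndepFun_infinitePi (P := fun _ => P) (X := fun _ => U) fun _ => hU
  have hint (i : ℕ) : ∫ ξ, U (ξ i) ∂ρ = ∫ x, U x ∂P := by
    have := (hmp i).map_eq
    conv_rhs => rw [← this]
    exact (integral_map (hmp i).aemeasurable hU.aestronglyMeasurable).symm
  -- The sequence space `ℕ → S` is an admissible sample space because `S` lives in the universe of
  -- `B`.
  have key := hb.2 m (ℕ → S) ρ (fun i ξ => U (ξ i)) (fun i => by fun_prop)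
    (fun i => MemLp.of_bound (hU.comp (measurable_pi_apply _)).aestronglyMeasurable C
      (ae_of_all _ fun ξ => hC _))
    (hind.precomp Fin.val_injective) (fun i => (hint i).trans h0)
  have h2 (i : ℕ) : ∫ ξ, ‖U (ξ i)‖ ^ 2 ∂ρ = ∫ x, ‖U x‖ ^ 2 ∂P := by
    have hm : Measurable fun x => ‖U x‖ ^ 2 := by fun_prop
    have := (hmp i).map_eq
    conv_rhs => rw [← this]
    exact (integral_map (hmp i).aemeasurable hm.aestronglyMeasurable).symm
  simp_rw [Finset.sum_range]
  refine key.trans (le_of_eq ?_)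
  simp [h2]

/-- Second moment bound for normalized sums. -/
lemma HasTypeTwoConst.integral_norm_normalized_sum_sq_le {b : ℝ} (hb : HasTypeTwoConst B b)
    (P : Measure S) [IsProbabilityMeasure P] {U : S → B} (hU : Measurable U) {C : ℝ}
    (hC : ∀ x, ‖U x‖ ≤ C) (h0 : ∫ x, U x ∂P = 0) (m : ℕ) :
    ∫ ξ, ‖(√(m : ℝ))⁻¹ • ∑ i ∈ Finset.range m, U (ξ i)‖ ^ 2
      ∂(Measure.infinitePi fun _ : ℕ => P) ≤ b * ∫ x, ‖U x‖ ^ 2 ∂P := by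
  have h := hb.integral_norm_sum_sq_le P hU hC h0 m
  have hI : 0 ≤ ∫ x, ‖U x‖ ^ 2 ∂P := integral_nonneg fun x => by positivity
  simp_rw [norm_smul, mul_pow, norm_inv, Real.norm_of_nonneg (Real.sqrt_nonneg _), inv_pow,
    Real.sq_sqrt (Nat.cast_nonneg m), integral_const_mul]
  rcases Nat.eq_zero_or_pos m with rfl | hm
  -- For `m = 0` the factor `(√0)⁻¹` is `0`, so the left side vanishes.
  · simpa using mul_nonneg hb.1.le hI
  · have hm' : (0 : ℝ) < m := by exact_mod_cast hm
    rw [inv_mul_le_iff₀ hm']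
    linarith

/-- Second moment bound for completely degenerate two-sample statistics. -/
lemma HasTypeTwoConst.integral_norm_degenerate_sum_sq_le {b : ℝ} (hb : HasTypeTwoConst B b)
    (P : Measure S) [IsProbabilityMeasure P] {r : S → S → B}
    (hr : Measurable (Function.uncurry r)) {C : ℝ}
    (hC : ∀ x z, ‖r x z‖ ≤ C) (hx : ∀ z, ∫ x, r x z ∂P = 0) (hz : ∀ x, ∫ z, r x z ∂P = 0)
    (m n : ℕ) :
    ∫ ω, ‖∑ i ∈ Finset.range m, ∑ j ∈ Finset.range n, r (ω.1 i) (ω.2 j)‖ ^ 2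
      ∂((Measure.infinitePi fun _ : ℕ => P).prod (Measure.infinitePi fun _ : ℕ => P)) ≤
      b ^ 2 * C ^ 2 * (m * n) := by
  set ρ := Measure.infinitePi fun _ : ℕ => P with hρ
  have hr' : Measurable fun p : S × S => r p.1 p.2 := hr
  have hrx (z : S) : Measurable fun x => r x z := hr'.comp (by fun_prop : Measurable fun x => (x, z))
  have hrz (x : S) : Measurable fun z => r x z := hr'.comp (by fun_prop : Measurable fun z => (x, z))
  have hmeas (i j : ℕ) : Measurable fun ω : (ℕ → S) × (ℕ → S) => r (ω.1 i) (ω.2 j) :=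
    hr'.comp (by fun_prop : Measurable fun ω : (ℕ → S) × (ℕ → S) => (ω.1 i, ω.2 j))
  have hC0 : 0 ≤ C := by
    obtain ⟨x⟩ := P.nonempty_of_neZero
    exact (norm_nonneg _).trans (hC x x)
  have hbd1 (ζ : ℕ → S) (x : S) : ‖∑ j ∈ Finset.range n, r x (ζ j)‖ ≤ n * C := by
    refine (norm_sum_le_of_le _ fun j _ => hC x (ζ j)).trans (by simp)
  have hS1 : Measurable fun ω : (ℕ → S) × (ℕ → S) =>
      ∑ i ∈ Finset.range m, ∑ j ∈ Finset.range n, r (ω.1 i) (ω.2 j) :=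
    Finset.measurable_sum _ fun i _ => Finset.measurable_sum _ fun j _ => hmeas i j
  have hI : Integrable (fun ω : (ℕ → S) × (ℕ → S) =>
      ‖∑ i ∈ Finset.range m, ∑ j ∈ Finset.range n, r (ω.1 i) (ω.2 j)‖ ^ 2) (ρ.prod ρ) :=
    integrable_norm_sq_of_bound hS1 (C := m * (n * C)) fun ω =>
      (norm_sum_le_of_le _ fun i _ => hbd1 ω.2 (ω.1 i)).trans (by simp)
  -- the inner second moment, as a function of the second sample
  have hS2 : Measurable fun p : S × (ℕ → S) => ∑ j ∈ Finset.range n, r p.1 (p.2 j) :=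
    Finset.measurable_sum _ fun j _ =>
      hr'.comp (by fun_prop : Measurable fun p : S × (ℕ → S) => (p.1, p.2 j))
  have hI2 : Integrable (fun p : S × (ℕ → S) => ‖∑ j ∈ Finset.range n, r p.1 (p.2 j)‖ ^ 2)
      (P.prod ρ) := integrable_norm_sq_of_bound hS2 fun p => hbd1 p.2 p.1
  -- With the second sample frozen, the outer sum is an i.i.d. centered sum in the first, and type 2
  -- applies; after exchanging the integrals, the inner sum is treated the same way with `x` frozen.
  -- Each use gives a factor `b` and a number of terms rather than its square.
  calc ∫ ω, ‖∑ i ∈ Finset.range m, ∑ j ∈ Finset.range n, r (ω.1 i) (ω.2 j)‖ ^ 2 ∂(ρ.prod ρ)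
      = ∫ ζ, ∫ ξ, ‖∑ i ∈ Finset.range m, ∑ j ∈ Finset.range n, r (ξ i) (ζ j)‖ ^ 2 ∂ρ ∂ρ :=
        integral_prod_symm _ hI
    _ ≤ ∫ ζ, b * (m * ∫ x, ‖∑ j ∈ Finset.range n, r x (ζ j)‖ ^ 2 ∂P) ∂ρ := by
        refine integral_mono hI.integral_prod_right ((hI2.integral_prod_right.const_mul _).const_mul _) ?_
        intro ζ
        refine hb.integral_norm_sum_sq_le P (U := fun x => ∑ j ∈ Finset.range n, r x (ζ j))
          (Finset.measurable_sum _ fun j _ => hrx _) (hbd1 ζ) ?_ m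
        rw [integral_finsetSum _ fun j _ =>
          Integrable.of_bound (hrx _).aestronglyMeasurable C (ae_of_all _ fun x => hC _ _)]
        exact Finset.sum_eq_zero fun j _ => hx _
    _ = b * (m * ∫ x, ∫ ζ, ‖∑ j ∈ Finset.range n, r x (ζ j)‖ ^ 2 ∂ρ ∂P) := by
        rw [integral_const_mul, integral_const_mul, integral_integral_swap]
        exact hI2.swap
    _ ≤ b * (m * ∫ x, b * (n * C ^ 2) ∂P) := by
        have := hb.1.le
        gcongr
        · exact hI2.integral_prod_left
        · exact integrable_const _
        · intro x
          refine (hb.integral_norm_sum_sq_le P (U := fun z => r x z) (hrz x) (hC x) (hz x) n).trans ?_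
          have : ∫ z, ‖r x z‖ ^ 2 ∂P ≤ C ^ 2 := by
            refine (integral_mono (integrable_norm_sq_of_bound (hrz x) (hC x))
              (integrable_const (C ^ 2)) fun z => ?_).trans (by simp)
            exact pow_le_pow_left₀ (norm_nonneg _) (hC x z) 2
          exact mul_le_mul_of_nonneg_left
            (mul_le_mul_of_nonneg_left this (Nat.cast_nonneg n)) hb.1.le
    _ = b ^ 2 * C ^ 2 * (m * n) := by
        simp
        ring

/-- If `u_k → 0` pointwise, with a common bound and zero means, then the normalized sums of the
`u_k` along an i.i.d. sequence tend to `0` in mean square. -/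
lemma HasTypeTwoConst.tendsto_integral_norm_normalized_sum_sq {b : ℝ} (hb : HasTypeTwoConst B b)
    (P : Measure S) [IsProbabilityMeasure P] {U : ℕ → S → B} (hU : ∀ k, Measurable (U k)) {C : ℝ}
    (hC : ∀ k x, ‖U k x‖ ≤ C) (h0 : ∀ k, ∫ x, U k x ∂P = 0)
    (hlim : ∀ x, Tendsto (fun k => U k x) atTop (𝓝 0)) (m : ℕ → ℕ) :
    Tendsto (fun k => ∫ ξ, ‖(√(m k : ℝ))⁻¹ • ∑ i ∈ Finset.range (m k), U k (ξ i)‖ ^ 2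
      ∂(Measure.infinitePi fun _ : ℕ => P)) atTop (𝓝 0) := by
  have h1 : Tendsto (fun k => ∫ x, ‖U k x‖ ^ 2 ∂P) atTop (𝓝 0) := by
    have : Tendsto (fun k => ∫ x, ‖U k x‖ ^ 2 ∂P) atTop (𝓝 (∫ _, (0 : ℝ) ∂P)) := by
      refine tendsto_integral_of_dominated_convergence (fun _ => C ^ 2)
        (fun k => (by fun_prop : Measurable fun x => ‖U k x‖ ^ 2).aestronglyMeasurable)
        (integrable_const _) (fun k => ae_of_all _ fun x => ?_) (ae_of_all _ fun x => ?_)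
      · rw [Real.norm_of_nonneg (by positivity)]
        have := hC k x
        gcongr
      · simpa using ((hlim x).norm.pow 2)
    simpa using this
  refine squeeze_zero (fun k => integral_nonneg fun _ => by positivity)
    (fun k => hb.integral_norm_normalized_sum_sq_le P (hU k) (hC k) (h0 k) (m k)) ?_
  simpa using h1.const_mul b

end TypeTwo

/-! ### Tightness and weak convergence via characteristic functions. -/

section Weak

/-- A set of measures which is, up to small mass, contained in small neighbourhoods of compact
sets is tight. -/
lemma isTightMeasureSet_of_cthickening {E : Type*} [NormedAddCommGroup E] [MeasurableSpace E]
    [CompleteSpace E] {𝓢 : Set (Measure E)}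
    (h : ∀ ε > (0 : ℝ), ∀ δ > (0 : ℝ), ∃ K : Set E, IsCompact K ∧
      ∀ μ ∈ 𝓢, μ (Metric.cthickening δ K)ᶜ ≤ ENNReal.ofReal ε) :
    IsTightMeasureSet 𝓢 := by
  rw [isTightMeasureSet_iff_exists_isCompact_measure_compl_le]
  intro ε hε
  -- Summable errors allow one compact set per radius `1 / (n + 1)`; the intersection of the
  -- thickenings is closed and totally bounded, hence compact.
  obtain ⟨ε', hε'pos, hε'sum⟩ := ENNReal.exists_pos_sum_of_countable hε.ne' ℕ
  choose K hK hKS using fun n : ℕ => h (ε' n : ℝ) (by exact_mod_cast hε'pos n)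
    (1 / ((n : ℝ) + 1)) (by positivity)
  refine ⟨⋂ n : ℕ, Metric.cthickening (1 / ((n : ℝ) + 1)) (K n), ?_, fun μ hμ => ?_⟩
  · refine TotallyBounded.isCompact_of_isClosed ?_
      (isClosed_iInter fun n => Metric.isClosed_cthickening)
    rw [Metric.totallyBounded_iff]
    intro η hη
    obtain ⟨n, hn⟩ := exists_nat_one_div_lt (half_pos hη)
    obtain ⟨t, ht, hcov⟩ := Metric.totallyBounded_iff.1 (hK n).totallyBounded (η / 2) (half_pos hη)
    refine ⟨t, ht, fun x hx => ?_⟩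
    have hx' := mem_iInter.1 hx n
    rw [(hK n).cthickening_eq_biUnion_closedBall (by positivity)] at hx'
    obtain ⟨y, hy, hxy⟩ := mem_iUnion₂.1 hx'
    obtain ⟨z, hz, hyz⟩ := mem_iUnion₂.1 (hcov hy)
    refine mem_iUnion₂.2 ⟨z, hz, ?_⟩
    rw [Metric.mem_ball] at hyz ⊢
    rw [Metric.mem_closedBall] at hxy
    linarith [dist_triangle x y z]
  · rw [compl_iInter]
    refine (measure_iUnion_le _).trans (le_trans (ENNReal.tsum_le_tsum fun n => ?_) hε'sum.le)
    simpa using hKS n μ hμ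

variable {E : Type*} [NormedAddCommGroup E] [MeasurableSpace E] [BorelSpace E] [NormedSpace ℝ E]

lemma continuous_charFunDual_probabilityMeasure (L : StrongDual ℝ E) :
    Continuous fun ν : ProbabilityMeasure E => charFunDual (ν : Measure E) L := by
  rw [continuous_iff_continuousAt]
  intro ν
  have h := (ProbabilityMeasure.tendsto_iff_forall_integral_rclike_tendsto ℂ).1
    (tendsto_id : Tendsto id (𝓝 ν) (𝓝 ν))
  have := h (BoundedContinuousFunction.ofNormedAddCommGroup
    (fun v : E => Complex.exp (L v * Complex.I)) (by fun_prop) 1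
    (fun v => by simp [Complex.norm_exp]))
  simpa [ContinuousAt, charFunDual_apply] using this

/-- A tight sequence of probability measures whose characteristic functions converge pointwise
converges weakly. -/
lemma exists_tendsto_of_isTight_of_tendsto_charFunDual [CompleteSpace E]
    [SecondCountableTopology E] {ν : ℕ → ProbabilityMeasure E}
    (ht : IsTightMeasureSet {(ν n : Measure E) | n}) {φ : StrongDual ℝ E → ℂ}
    (h : ∀ L, Tendsto (fun n => charFunDual (ν n : Measure E) L) atTop (𝓝 (φ L))) :
    ∃ G : ProbabilityMeasure E, (∀ L, charFunDual (G : Measure E) L = φ L) ∧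
      Tendsto ν atTop (𝓝 G) := by
  -- Prokhorov's theorem. Every cluster point has characteristic function `φ`, so there is only one,
  -- and in a compact set this forces convergence.
  have hK : IsCompact (closure (range ν)) := by
    refine isCompact_closure_of_isTightMeasureSet ?_
    convert ht using 1
    ext μ
    simp
  have hmem : ∀ᶠ n in atTop, ν n ∈ closure (range ν) :=
    Eventually.of_forall fun n => subset_closure (mem_range_self n)
  have hcl {ν₀ : ProbabilityMeasure E} (hν₀ : MapClusterPt ν₀ atTop ν) (L : StrongDual ℝ E) :
      charFunDual (ν₀ : Measure E) L = φ L := by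
    have h1 := hν₀.tendsto_comp ((continuous_charFunDual_probabilityMeasure L).tendsto ν₀)
    have h2 : ClusterPt (charFunDual (ν₀ : Measure E) L) (𝓝 (φ L)) :=
      ClusterPt.mono h1 (h L)
    exact eq_of_nhds_neBot h2
  obtain ⟨G, -, hG⟩ := hK.exists_mapClusterPt (f := atTop) (u := ν) (by simpa using hmem)
  refine ⟨G, hcl hG, ?_⟩
  refine hK.le_nhds_of_unique_clusterPt (by simpa using hmem) fun ν₀ _ hν₀ => ?_
  have hext : (ν₀ : Measure E) = (G : Measure E) :=
    Measure.ext_of_charFunDual (funext fun L => (hcl hν₀ L).trans (hcl hG L).symm)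
  exact Subtype.ext hext

end Weak

/-- Chebyshev's inequality. -/
lemma measure_le_norm_le_of_integral_sq_le {B α : Type*} [NormedAddCommGroup B]
    [MeasurableSpace α] {μ : Measure α}
    [IsFiniteMeasure μ] {f : α → B} (hI : Integrable (fun x => ‖f x‖ ^ 2) μ) {M δ : ℝ}
    (hδ : 0 < δ) (hM : ∫ x, ‖f x‖ ^ 2 ∂μ ≤ M) :
    μ {x | δ ≤ ‖f x‖} ≤ ENNReal.ofReal (M / δ ^ 2) := by
  have h := mul_meas_ge_le_integral_of_nonneg (ae_of_all μ fun x => sq_nonneg ‖f x‖) hI (δ ^ 2)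
  have hset : {x | δ ≤ ‖f x‖} = {x | δ ^ 2 ≤ ‖f x‖ ^ 2} := by
    ext x
    exact (sq_le_sq₀ hδ.le (norm_nonneg _)).symm
  rw [hset, ← ofReal_measureReal]
  refine ENNReal.ofReal_le_ofReal ?_
  rw [le_div_iff₀' (by positivity)]
  exact h.trans hM

/-! ### The central limit theorem in spaces of type 2. -/

section CLT

variable {B : Type u} [NormedAddCommGroup B] [NormedSpace ℝ B] [MeasurableSpace B] [BorelSpace B]
  [SecondCountableTopology B] {S : Type u} [MeasurableSpace S]

/-- The normalized sum `n^{-1/2} (g(ξ₀) + ⋯ + g(ξ_{n-1}))`. -/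
noncomputable def normSum {B S : Type*} [NormedAddCommGroup B] [NormedSpace ℝ B]
    (g : S → B) (n : ℕ) (ξ : ℕ → S) : B :=
  (√(n : ℝ))⁻¹ • ∑ i ∈ Finset.range n, g (ξ i)

@[fun_prop]
lemma measurable_normSum {g : S → B} (hg : Measurable g) (n : ℕ) : Measurable (normSum g n) := by
  have : Measurable fun ξ : ℕ → S => ∑ i ∈ Finset.range n, g (ξ i) :=
    Finset.measurable_sum _ fun i _ => hg.comp (measurable_pi_apply i)
  exact this.const_smul _

lemma norm_normSum_le {B S : Type*} [NormedAddCommGroup B] [NormedSpace ℝ B] {g : S → B} {C : ℝ}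
    (hC : ∀ x, ‖g x‖ ≤ C) (n : ℕ) (ξ : ℕ → S) : ‖normSum g n ξ‖ ≤ (√(n : ℝ))⁻¹ * (n * C) := by
  rw [normSum, norm_smul, norm_inv, Real.norm_of_nonneg (Real.sqrt_nonneg _)]
  gcongr
  exact (norm_sum_le_of_le _ fun i _ => hC _).trans (by simp)

/-- This is the real central limit theorem for the bounded centered variables `L (g (ξ i))`; it
identifies the only possible weak limit. -/
lemma tendsto_charFunDual_map_normSum [CompleteSpace B] (P : Measure S) [IsProbabilityMeasure P] {g : S → B}
    (hg : Measurable g) {C : ℝ} (hC : ∀ x, ‖g x‖ ≤ C) (h0 : ∫ x, g x ∂P = 0)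
    (L : StrongDual ℝ B) :
    Tendsto (fun n => charFunDual ((Measure.infinitePi fun _ : ℕ => P).map (normSum g n)) L) atTop
      (𝓝 (Complex.exp (-((∫ x, L (g x) ^ 2 ∂P : ℝ) : ℂ) / 2))) := by
  set ρ := Measure.infinitePi fun _ : ℕ => P with hρ
  have hLg : Measurable fun x => L (g x) := by fun_prop
  have hmp (i : ℕ) : MeasurePreserving (fun ξ : ℕ → S => ξ i) ρ P :=
    measurePreserving_eval_infinitePi (fun _ => P) i
  have hXm (i : ℕ) : Measurable fun ξ : ℕ → S => L (g (ξ i)) := hLg.comp (measurable_pi_apply i)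
  have hbd (x : S) : ‖L (g x)‖ ≤ ‖L‖ * C := (L.le_opNorm _).trans (by gcongr; exact hC x)
  have hintg : Integrable g P := Integrable.of_bound hg.aestronglyMeasurable C (ae_of_all _ hC)
  have hmean : ∫ ξ, L (g (ξ 0)) ∂ρ = 0 := by
    have := (hmp 0).map_eq
    calc ∫ ξ, L (g (ξ 0)) ∂ρ = ∫ x, L (g x) ∂(ρ.map fun ξ => ξ 0) :=
          (integral_map (hmp 0).aemeasurable hLg.aestronglyMeasurable).symm
      _ = 0 := by rw [this, L.integral_comp_comm hintg, h0, map_zero]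
  have hvar : Var[fun ξ : ℕ → S => L (g (ξ 0)); ρ] = ∫ x, L (g x) ^ 2 ∂P := by
    rw [variance_of_integral_eq_zero (hXm 0).aemeasurable hmean]
    have := (hmp 0).map_eq
    conv_rhs => rw [← this]
    exact (integral_map (hmp 0).aemeasurable (hLg.pow_const 2).aestronglyMeasurable).symm
  have hclt := tendstoInDistribution_inv_sqrt_mul_sum_sub (P := ρ)
    (X := fun (i : ℕ) ξ => L (g (ξ i)))
    (P' := gaussianReal 0 Var[fun ξ : ℕ → S => L (g (ξ 0)); ρ].toNNReal) (Y := id)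
    ⟨aemeasurable_id, Measure.map_id⟩
    (MemLp.of_bound (hXm 0).aestronglyMeasurable _ (ae_of_all _ fun ξ => hbd _))
    (iIndepFun_infinitePi (P := fun _ => P) (X := fun _ x => L (g x)) fun _ => hLg)
    (fun i => ⟨(hXm i).aemeasurable, (hXm 0).aemeasurable, by
      change ρ.map ((fun x => L (g x)) ∘ fun ξ => ξ i) = ρ.map ((fun x => L (g x)) ∘ fun ξ => ξ 0)
      rw [← Measure.map_map hLg (by fun_prop), ← Measure.map_map hLg (by fun_prop),
        (hmp i).map_eq, (hmp 0).map_eq]⟩)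
  -- The characteristic function at `L` is that of the image under `L` at the point `1`.
  have h1 := ProbabilityMeasure.tendsto_iff_tendsto_charFun.1 hclt.tendsto 1
  simp only [hmean, mul_zero, sub_zero, ProbabilityMeasure.coe_mk, Measure.map_id,
    charFun_gaussianReal] at h1
  have hnn : 0 ≤ ∫ x, L (g x) ^ 2 ∂P := integral_nonneg fun x => sq_nonneg _
  refine (h1.congr fun n => ?_).trans (le_of_eq ?_)
  · rw [charFunDual_eq_charFun_map_one, Measure.map_map (by fun_prop) (measurable_normSum hg n)]
    congr 2
    ext ξ
    simp [normSum]
  · congr 2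
    rw [hvar, Real.coe_toNNReal _ hnn]
    simp [neg_div]

/-- Approximate `g` by a centered simple function `w k`. Sums of `w k` stay in a finite-dimensional
subspace and, by type 2, in a large ball of it up to small probability; sums of the error `v k` are
uniformly small in probability, again by type 2. Both bounds are uniform in the number of terms. -/
lemma isTightMeasureSet_map_normSum [CompleteSpace B] {b : ℝ} (hb : HasTypeTwoConst B b)
    (P : Measure S) [IsProbabilityMeasure P] {g : S → B}
    (hg : Measurable g) {C : ℝ} (hC : ∀ x, ‖g x‖ ≤ C) (h0 : ∫ x, g x ∂P = 0) :
    IsTightMeasureSet {(Measure.infinitePi fun _ : ℕ => P).map (normSum g n) | n} := by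
  set ρ := Measure.infinitePi fun _ : ℕ => P with hρ
  have hC0 : 0 ≤ C := by
    obtain ⟨x⟩ := P.nonempty_of_neZero
    exact (norm_nonneg _).trans (hC x)
  have hsm : StronglyMeasurable g := hg.stronglyMeasurable
  refine isTightMeasureSet_of_cthickening fun ε hε δ hδ => ?_
  let s (k : ℕ) (x : S) : B := hsm.approxBounded C k x
  have hs (k : ℕ) : Measurable (s k) := (hsm.approxBounded C k).measurable
  have hsC (k : ℕ) (x : S) : ‖s k x‖ ≤ C := hsm.norm_approxBounded_le hC0 k x
  have hslim (x : S) : Tendsto (fun k => s k x) atTop (𝓝 (g x)) :=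
    hsm.tendsto_approxBounded_of_norm_le (hC x)
  have hsint (k : ℕ) : Integrable (s k) P :=
    Integrable.of_bound (hs k).aestronglyMeasurable C (ae_of_all _ (hsC k))
  have hgint : Integrable g P := Integrable.of_bound hg.aestronglyMeasurable C (ae_of_all _ hC)
  have hmean : Tendsto (fun k => ∫ x, s k x ∂P) atTop (𝓝 0) := by
    rw [← h0]
    exact tendsto_integral_of_dominated_convergence (fun _ => C)
      (fun k => (hs k).aestronglyMeasurable) (integrable_const _)
      (fun k => ae_of_all _ (hsC k)) (ae_of_all _ hslim)
  have hmeanC (k : ℕ) : ‖∫ x, s k x ∂P‖ ≤ C := by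
    simpa using norm_integral_le_of_norm_le_const (μ := P) (ae_of_all _ (hsC k))
  let v (k : ℕ) (x : S) : B := g x - (s k x - ∫ x, s k x ∂P)
  let w (k : ℕ) (x : S) : B := s k x - ∫ x, s k x ∂P
  have hw (k : ℕ) : Measurable (w k) := (hs k).sub_const _
  have hv (k : ℕ) : Measurable (v k) := hg.sub (hw k)
  have hwC (k : ℕ) (x : S) : ‖w k x‖ ≤ C + C := norm_sub_le_of_le (hsC k x) (hmeanC k)
  have hvC (k : ℕ) (x : S) : ‖v k x‖ ≤ C + (C + C) := norm_sub_le_of_le (hC x) (hwC k x)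
  have hw0 (k : ℕ) : ∫ x, w k x ∂P = 0 := by
    simp only [w]
    rw [integral_sub (hsint k) (integrable_const _)]
    simp
  have hwint (k : ℕ) : Integrable (w k) P := (hsint k).sub (integrable_const _)
  have hv0 (k : ℕ) : ∫ x, v k x ∂P = 0 := by
    change ∫ x, (g x - w k x) ∂P = 0
    rw [integral_sub hgint (hwint k), h0, hw0, sub_zero]
  have hvlim (x : S) : Tendsto (fun k => v k x) atTop (𝓝 0) := by
    simpa using (tendsto_const_nhds (x := g x)).sub ((hslim x).sub hmean)
  have hv2 : Tendsto (fun k => b * ∫ x, ‖v k x‖ ^ 2 ∂P) atTop (𝓝 0) := by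
    have : Tendsto (fun k => ∫ x, ‖v k x‖ ^ 2 ∂P) atTop (𝓝 (∫ _, (0 : ℝ) ∂P)) := by
      refine tendsto_integral_of_dominated_convergence (fun _ => (C + (C + C)) ^ 2)
        (fun k => ((hv k).norm.pow_const 2).aestronglyMeasurable)
        (integrable_const _) (fun k => ae_of_all _ fun x => ?_) (ae_of_all _ fun x => ?_)
      · rw [Real.norm_of_nonneg (by positivity)]
        exact pow_le_pow_left₀ (norm_nonneg _) (hvC k x) 2
      · simpa using ((hvlim x).norm.pow 2)
    simpa using this.const_mul b
  -- The index is fixed before `n`: the type 2 bound for the error does not depend on the number of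
  -- terms.
  obtain ⟨k, hk⟩ := (hv2.eventually (gt_mem_nhds (by positivity : 0 < ε / 2 * δ ^ 2))).exists
  set M : ℝ := b * ∫ x, ‖w k x‖ ^ 2 ∂P with hM
  have hM0 : 0 ≤ M := mul_nonneg hb.1.le (integral_nonneg fun x => by positivity)
  -- The `1` added to `M` keeps the radius positive when `M = 0`.
  obtain ⟨R, hR, hMR⟩ : ∃ R : ℝ, 0 < R ∧ M / R ^ 2 ≤ ε / 2 := by
    refine ⟨√(2 * (M + 1) / ε), by positivity, ?_⟩
    rw [Real.sq_sqrt (by positivity), div_div_eq_mul_div, div_le_div_iff₀ (by positivity) two_pos]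
    nlinarith
  have hfin : (range (w k)).Finite := by
    have : w k = (fun y => y - ∫ x, s k x ∂P) ∘ (hsm.approxBounded C k) := rfl
    rw [this, range_comp]
    exact (hsm.approxBounded C k).finite_range.image _
  let F : Submodule ℝ B := Submodule.span ℝ (range (w k))
  have : FiniteDimensional ℝ F := FiniteDimensional.span_of_finite ℝ hfin
  have : ProperSpace F := FiniteDimensional.proper_real F
  refine ⟨(fun y : F => (y : B)) '' Metric.closedBall 0 R,
    (isCompact_closedBall _ _).image continuous_subtype_val, ?_⟩
  rintro _ ⟨n, rfl⟩
  rw [Measure.map_apply (measurable_normSum hg n)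
    Metric.isClosed_cthickening.measurableSet.compl]
  have hsplit (ξ : ℕ → S) : normSum g n ξ - normSum (w k) n ξ = normSum (v k) n ξ := by
    simp only [normSum, ← smul_sub, ← Finset.sum_sub_distrib]
    rfl
  have hsub : normSum g n ⁻¹' (Metric.cthickening δ
      ((fun y : F => (y : B)) '' Metric.closedBall 0 R))ᶜ ⊆
      {ξ | δ ≤ ‖normSum (v k) n ξ‖} ∪ {ξ | R ≤ ‖normSum (w k) n ξ‖} := by
    intro ξ hξ
    by_contra hcon
    simp only [mem_union, mem_ofPred_eq, not_or, not_le] at hcon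
    refine hξ ?_
    have hF : normSum (w k) n ξ ∈ F := F.smul_mem _ (F.sum_mem fun i _ =>
      Submodule.subset_span (mem_range_self _))
    refine Metric.mem_cthickening_of_dist_le _ (normSum (w k) n ξ) _ _
      ⟨⟨_, hF⟩, by simpa using hcon.2.le, rfl⟩ ?_
    rw [dist_eq_norm, hsplit]
    exact hcon.1.le
  have hb1 : ρ {ξ | δ ≤ ‖normSum (v k) n ξ‖} ≤ ENNReal.ofReal (ε / 2) := by
    refine (measure_le_norm_le_of_integral_sq_le (integrable_norm_sq_of_bound
      (measurable_normSum (hv k) n) (norm_normSum_le (hvC k) n)) hδ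
      (hb.integral_norm_normalized_sum_sq_le P (hv k) (hvC k) (hv0 k) n)).trans
      (ENNReal.ofReal_le_ofReal ?_)
    rw [div_le_iff₀ (by positivity)]
    exact hk.le
  have hb2 : ρ {ξ | R ≤ ‖normSum (w k) n ξ‖} ≤ ENNReal.ofReal (ε / 2) :=
    (measure_le_norm_le_of_integral_sq_le (integrable_norm_sq_of_bound
      (measurable_normSum (hw k) n) (norm_normSum_le (hwC k) n)) hR
      (hb.integral_norm_normalized_sum_sq_le P (hw k) (hwC k) (hw0 k) n)).trans
      (ENNReal.ofReal_le_ofReal hMR)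
  calc _ ≤ _ := measure_mono hsub
    _ ≤ _ := measure_union_le _ _
    _ ≤ ENNReal.ofReal (ε / 2) + ENNReal.ofReal (ε / 2) := add_le_add hb1 hb2
    _ = ENNReal.ofReal ε := by
      rw [← ENNReal.ofReal_add (by positivity) (by positivity), add_halves]

lemma isProbabilityMeasure_map_normSum (P : Measure S) [IsProbabilityMeasure P] {g : S → B}
    (hg : Measurable g) (n : ℕ) :
    IsProbabilityMeasure ((Measure.infinitePi fun _ : ℕ => P).map (normSum g n)) :=
  Measure.isProbabilityMeasure_map (measurable_normSum hg n).aemeasurable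

/-- The central limit theorem for bounded centered random elements of a separable Banach space of
type 2. -/
theorem exists_tendsto_map_normSum [CompleteSpace B] {b : ℝ} (hb : HasTypeTwoConst B b)
    (P : Measure S) [IsProbabilityMeasure P] {g : S → B}
    (hg : Measurable g) {C : ℝ} (hC : ∀ x, ‖g x‖ ≤ C) (h0 : ∫ x, g x ∂P = 0) :
    ∃ G : ProbabilityMeasure B,
      (∀ L, charFunDual (G : Measure B) L =
        Complex.exp (-((∫ x, L (g x) ^ 2 ∂P : ℝ) : ℂ) / 2)) ∧
      Tendsto (β := ProbabilityMeasure B)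
        (fun n => ⟨(Measure.infinitePi fun _ : ℕ => P).map (normSum g n),
          isProbabilityMeasure_map_normSum P hg n⟩) atTop (𝓝 G) := by
  let ν : ℕ → ProbabilityMeasure B := fun n =>
    ⟨(Measure.infinitePi fun _ : ℕ => P).map (normSum g n), isProbabilityMeasure_map_normSum P hg n⟩
  have h : IsTightMeasureSet {(ν n : Measure B) | n} := isTightMeasureSet_map_normSum hb P hg hC h0
  exact exists_tendsto_of_isTight_of_tendsto_charFunDual h
    (tendsto_charFunDual_map_normSum P hg hC h0)

end CLT

/-! ### Separability of the space and measurability of dual-valued maps. -/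

section Dual

variable {E : Type u} [NormedAddCommGroup E] [NormedSpace ℝ E]

/-- A normed space with separable dual is separable. -/
lemma separableSpace_of_separableSpace_strongDual
    [TopologicalSpace.SeparableSpace (StrongDual ℝ E)] : TopologicalSpace.SeparableSpace E := by
  let L := TopologicalSpace.denseSeq (StrongDual ℝ E)
  -- Almost norming vectors for a dense sequence of functionals; the claim is that their closed span
  -- is everything.
  have hx (n : ℕ) : ∃ x : E, ‖x‖ ≤ 1 ∧ ‖L n‖ / 2 ≤ ‖L n x‖ := by
    rcases eq_or_ne (L n) 0 with h | h
    · exact ⟨0, by simp, by simp [h]⟩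
    · obtain ⟨x, hx1, hx2⟩ := (L n).exists_lt_apply_of_lt_opNorm
        (half_lt_self (norm_pos_iff.2 h))
      exact ⟨x, hx1.le, hx2.le⟩
  choose x hx1 hx2 using hx
  let T : Submodule ℝ E := (Submodule.span ℝ (range x)).topologicalClosure
  have hT : (T : Set E) = univ := by
    by_contra hne
    obtain ⟨y, hy⟩ := (ne_univ_iff_exists_notMem _).1 hne
    obtain ⟨f, c, hf, hfy⟩ := geometric_hahn_banach_closed_point T.convex
      (Submodule.isClosed_topologicalClosure _) hy
    have hc : 0 < c := by simpa using hf 0 T.zero_mem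
    -- A linear functional bounded above on a subspace vanishes there: rescale `a` so that `f` takes
    -- the value `c`.
    have hf0 (a : E) (ha : a ∈ T) : f a = 0 := by
      by_contra hne
      have := hf ((c / f a) • a) (T.smul_mem _ ha)
      rw [map_smul, smul_eq_mul, div_mul_cancel₀ _ hne] at this
      exact lt_irrefl _ this
    have hfne : 0 < ‖f‖ := by
      rw [norm_pos_iff]
      rintro rfl
      simp at hfy
      linarith
    obtain ⟨n, hn⟩ := (TopologicalSpace.denseRange_denseSeq (StrongDual ℝ E)).exists_dist_lt f
      (show 0 < ‖f‖ / 4 by positivity)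
    rw [dist_eq_norm] at hn
    have hxT : x n ∈ T := Submodule.le_topologicalClosure _ (Submodule.subset_span ⟨n, rfl⟩)
    -- Since `f (x n) = 0`, `‖L n‖ ≤ 2 * ‖f - L n‖`, so `‖f‖ ≤ 3 * ‖f - L n‖ < 3 / 4 * ‖f‖`, a
    -- contradiction.
    have h1 : ‖L n (x n)‖ ≤ ‖f - L n‖ := by
      have := (f - L n).unit_le_opNorm (x n) (hx1 n)
      simpa [hf0 _ hxT] using this
    have h2 : ‖f‖ ≤ ‖f - L n‖ + ‖L n‖ := by simpa using norm_add_le (f - L n) (L n)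
    have h3 := hx2 n
    have h4 : ‖f - L n‖ < ‖f‖ / 4 := hn
    linarith
  have hs := ((countable_range x).isSeparable.span (R := ℝ)).closure
  rw [← TopologicalSpace.isSeparable_univ_iff, ← hT]
  exact hs

/-- A map into a separable dual is Borel measurable as soon as all its evaluations are. -/
lemma measurable_of_forall_measurable_apply [TopologicalSpace.SeparableSpace E]
    [SecondCountableTopology (StrongDual ℝ E)] {α : Type*} [MeasurableSpace α]
    {f : α → StrongDual ℝ E} (hf : ∀ h : E, Measurable fun a => f a h) : Measurable f := by
  -- The dual norm is determined by countably many evaluations, so preimages of balls are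
  -- measurable; in a second countable dual the balls generate the Borel sets.
  have hnorm (c : StrongDual ℝ E) : Measurable fun a => ‖f a - c‖ := by
    refine measurable_of_Iic fun r => ?_
    rcases lt_or_ge r 0 with hr | hr
    · convert MeasurableSet.empty
      ext a
      simpa using hr.trans_le (norm_nonneg _)
    · have : (fun a => ‖f a - c‖) ⁻¹' Iic r = ⋂ n : ℕ,
          {a | ‖f a (TopologicalSpace.denseSeq E n) - c (TopologicalSpace.denseSeq E n)‖ ≤
            r * ‖TopologicalSpace.denseSeq E n‖} := by
        ext a
        simp only [mem_preimage, mem_Iic, mem_iInter, mem_ofPred_eq]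
        refine ⟨fun h n => (f a - c).le_of_opNorm_le h _, fun h => ?_⟩
        refine ContinuousLinearMap.opNorm_le_bound _ hr fun x => ?_
        refine (TopologicalSpace.denseRange_denseSeq E).induction_on x ?_ h
        exact isClosed_le (by fun_prop) (by fun_prop)
      rw [this]
      refine MeasurableSet.iInter fun n => ?_
      exact measurableSet_le ((hf _).sub_const _).norm measurable_const
  have hbasis : TopologicalSpace.IsTopologicalBasis
      {s : Set (StrongDual ℝ E) | ∃ c r, s = Metric.ball c r} := by
    refine TopologicalSpace.isTopologicalBasis_of_isOpen_of_nhds ?_ ?_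
    · rintro _ ⟨c, r, rfl⟩
      exact Metric.isOpen_ball
    · intro c U hc hU
      obtain ⟨r, hr, hrU⟩ := Metric.isOpen_iff.1 hU c hc
      exact ⟨_, ⟨c, r, rfl⟩, Metric.mem_ball_self hr, hrU⟩
  rw [BorelSpace.measurable_eq (α := StrongDual ℝ E), hbasis.borel_eq_generateFrom]
  refine measurable_generateFrom ?_
  rintro _ ⟨c, r, rfl⟩
  have : f ⁻¹' Metric.ball c r = {a | ‖f a - c‖ < r} := by
    ext a
    simp [dist_eq_norm]
  rw [this]
  exact measurableSet_lt (hnorm c) measurable_const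

end Dual

/-! ### The sign: bound, oddness, continuity along lines, measurability. -/

section Sign

variable {E : Type u} [NormedAddCommGroup E] [NormedSpace ℝ E]

lemma HasGateauxDerivAt.unique {f : E → ℝ} {L L' : StrongDual ℝ E} {x : E}
    (h : HasGateauxDerivAt f L x) (h' : HasGateauxDerivAt f L' x) : L = L' :=
  ContinuousLinearMap.ext fun v => (h v).unique (h' v)

@[simp]
lemma SGN_zero : SGN (0 : E) = 0 := by simp [SGN]

lemma SGN_eq {x : E} (hx : x ≠ 0) {L : StrongDual ℝ E}
    (hL : HasGateauxDerivAt (fun y : E => ‖y‖) L x) : SGN x = L := by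
  have h : x ≠ 0 ∧ ∃ L : StrongDual ℝ E, HasGateauxDerivAt (fun y : E => ‖y‖) L x := ⟨hx, L, hL⟩
  rw [SGN, dif_pos h]
  exact h.2.choose_spec.unique hL

lemma norm_le_one_of_hasGateauxDerivAt_norm {x : E} {L : StrongDual ℝ E}
    (hL : HasGateauxDerivAt (fun y : E => ‖y‖) L x) : ‖L‖ ≤ 1 :=
  L.opNorm_le_bound zero_le_one fun v => (hL v).le_of_lipschitz lipschitzWith_one_norm

/-- The norm is 1-Lipschitz, so its directional derivatives are at most the length of the direction;
the default value `0` obeys the bound too. -/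
lemma norm_SGN_le (x : E) : ‖SGN x‖ ≤ 1 := by
  by_cases h : x ≠ 0 ∧ ∃ L : StrongDual ℝ E, HasGateauxDerivAt (fun y : E => ‖y‖) L x
  · obtain ⟨hx, L, hL⟩ := h
    rw [SGN_eq hx hL]
    exact norm_le_one_of_hasGateauxDerivAt_norm hL
  · rw [SGN, dif_neg h]
    simp

lemma HasGateauxDerivAt.norm_neg {x : E} {L : StrongDual ℝ E}
    (hL : HasGateauxDerivAt (fun y : E => ‖y‖) L x) :
    HasGateauxDerivAt (fun y : E => ‖y‖) (-L) (-x) := by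
  intro v
  have h := hL (-v)
  rw [hasLineDerivAt_iff_tendsto_slope_zero] at h ⊢
  have he (t : ℝ) : ‖-x + t • v‖ = ‖x + t • -v‖ := by
    rw [← _root_.norm_neg]
    congr 1
    simp [add_comm]
  simpa [he] using h

lemma hasGateauxDerivAt_SGN
    (hnorm : ∀ x : E, x ≠ 0 → TwiceGateauxDifferentiableAt (fun y : E => ‖y‖) x) {x : E}
    (hx : x ≠ 0) : HasGateauxDerivAt (fun y : E => ‖y‖) (SGN x) x := by
  obtain ⟨D, hD, -⟩ := hnorm x hx
  have := hD.self_of_nhds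
  rwa [SGN_eq hx this]

lemma SGN_neg (hnorm : ∀ x : E, x ≠ 0 → TwiceGateauxDifferentiableAt (fun y : E => ‖y‖) x)
    (x : E) : SGN (-x) = -SGN x := by
  rcases eq_or_ne x 0 with rfl | hx
  · simp
  · exact SGN_eq (neg_ne_zero.2 hx) (hasGateauxDerivAt_SGN hnorm hx).norm_neg

/-- Along lines through a point `x ≠ 0`, the sign is continuous in norm. -/
lemma tendsto_SGN_add_smul [CompleteSpace E]
    (hnorm : ∀ x : E, x ≠ 0 → TwiceGateauxDifferentiableAt (fun y : E => ‖y‖) x) {x : E}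
    (hx : x ≠ 0) (δ : E) {t : ℕ → ℝ} (ht : Tendsto t atTop (𝓝 0)) (htne : ∀ᶠ k in atTop, t k ≠ 0) :
    Tendsto (fun k => SGN (x + t k • δ)) atTop (𝓝 (SGN x)) := by
  obtain ⟨D, hD, T, hT⟩ := hnorm x hx
  have hDx : ∀ᶠ y in 𝓝 x, D y = SGN y := by
    filter_upwards [hD, isOpen_ne.mem_nhds hx] with y hy hy0
    exact (SGN_eq hy0 hy).symm
  have hline : Tendsto (fun k => x + t k • δ) atTop (𝓝 x) := by
    simpa using tendsto_const_nhds.add (ht.smul_const δ)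
  have htn : Tendsto t atTop (𝓝[≠] 0) := tendsto_nhdsWithin_iff.2 ⟨ht, htne⟩
  let F (k : ℕ) : StrongDual ℝ E := (t k)⁻¹ • (D (x + t k • δ) - D x)
  -- The second derivative gives convergence of the difference quotients `F k` only at each vector.
  -- Uniform boundedness, which uses completeness of `E`, turns this into a bound in norm, so the
  -- increment of the sign is `O(|t k|)`.
  obtain ⟨C, hC⟩ := banach_steinhaus (g := F) fun v => by
    have h := (hT δ v).tendsto_slope_zero.comp htn
    obtain ⟨M, hM⟩ := h.norm.bddAbove_range
    exact ⟨M, fun k => by simpa [F] using hM (mem_range_self k)⟩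
  have hbound : ∀ᶠ k in atTop, ‖SGN (x + t k • δ) - SGN x‖ ≤ |t k| * C := by
    filter_upwards [hline.eventually hDx, htne] with k hk hk0
    rw [← hk, ← hDx.self_of_nhds]
    have h2 : D (x + t k • δ) - D x = t k • F k := by
      simp only [F]
      rw [smul_smul, mul_inv_cancel₀ hk0, one_smul]
    rw [h2, norm_smul, Real.norm_eq_abs]
    gcongr
    exact hC k
  rw [tendsto_iff_norm_sub_tendsto_zero]
  refine squeeze_zero' (Eventually.of_forall fun k => norm_nonneg _) hbound ?_
  simpa using ht.abs.mul_const C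

/-- Each evaluation is a pointwise limit of difference quotients of the norm, set to `0` at the
origin; this suffices in a separable dual. -/
lemma measurable_SGN [MeasurableSpace E] [BorelSpace E] [TopologicalSpace.SeparableSpace E]
    [SecondCountableTopology (StrongDual ℝ E)]
    (hnorm : ∀ x : E, x ≠ 0 → TwiceGateauxDifferentiableAt (fun y : E => ‖y‖) x) :
    Measurable (SGN : E → StrongDual ℝ E) := by
  classical
  refine measurable_of_forall_measurable_apply fun v => ?_
  let t (k : ℕ) : ℝ := 1 / ((k : ℝ) + 1)
  have ht : Tendsto t atTop (𝓝[≠] 0) := by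
    refine tendsto_nhdsWithin_iff.2 ⟨tendsto_one_div_add_atTop_nhds_zero_nat, ?_⟩
    exact Eventually.of_forall fun k => (one_div_pos.2 (by positivity)).ne'
  refine measurable_of_tendsto_metrizable (f := fun k x => if x = 0 then (0 : ℝ) else
    (t k)⁻¹ • (‖x + t k • v‖ - ‖x‖)) (fun k => ?_) (tendsto_pi_nhds.2 fun x => ?_)
  · refine Measurable.ite (measurableSet_singleton 0) measurable_const ?_
    have : Continuous fun x : E => (t k)⁻¹ • (‖x + t k • v‖ - ‖x‖) := by fun_prop
    exact this.measurable
  · by_cases hx : x = 0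
    · simp [hx]
    · simp only [hx, if_false]
      exact (hasGateauxDerivAt_SGN hnorm hx v).tendsto_slope_zero.comp ht

end Sign

/-! ### Convergence to zero in measure. -/

section InMeasure

variable {α B : Type*} [MeasurableSpace α] {μ : Measure α} [NormedAddCommGroup B]

lemma tendstoInMeasure_zero_add {f g : ℕ → α → B} (hf : TendstoInMeasure μ f atTop 0)
    (hg : TendstoInMeasure μ g atTop 0) : TendstoInMeasure μ (fun k x => f k x + g k x) atTop 0 := by
  rw [tendstoInMeasure_iff_norm] at hf hg ⊢
  intro ε hε
  have h := (hf (ε / 2) (half_pos hε)).add (hg (ε / 2) (half_pos hε))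
  rw [add_zero] at h
  refine tendsto_of_tendsto_of_tendsto_of_le_of_le tendsto_const_nhds h (fun _ => zero_le)
    fun k => (measure_mono fun x hx => ?_).trans (measure_union_le _ _)
  by_contra hcon
  simp only [mem_union, mem_ofPred_eq, not_or, not_le, Pi.zero_apply, sub_zero] at hcon hx
  linarith [norm_add_le (f k x) (g k x)]

lemma tendstoInMeasure_zero_of_tendsto_integral_sq [IsFiniteMeasure μ] {f : ℕ → α → B}
    (hI : ∀ k, Integrable (fun x => ‖f k x‖ ^ 2) μ)
    (h : Tendsto (fun k => ∫ x, ‖f k x‖ ^ 2 ∂μ) atTop (𝓝 0)) : TendstoInMeasure μ f atTop 0 := by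
  rw [tendstoInMeasure_iff_norm]
  intro ε hε
  have h' : Tendsto (fun k => ENNReal.ofReal ((∫ x, ‖f k x‖ ^ 2 ∂μ) / ε ^ 2)) atTop (𝓝 0) := by
    simpa using ENNReal.tendsto_ofReal (h.div_const (ε ^ 2))
  refine tendsto_of_tendsto_of_tendsto_of_le_of_le tendsto_const_nhds h' (fun _ => zero_le)
    fun k => ?_
  simpa using measure_le_norm_le_of_integral_sq_le (hI k) hε le_rfl

end InMeasure

/-! ### The Hoeffding decomposition of a two-sample kernel. -/

section Hoeffding

variable {B : Type u} [NormedAddCommGroup B] [NormedSpace ℝ B] {S : Type u} [MeasurableSpace S]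

/-- The mean of a kernel under `P ⊗ P`. -/
noncomputable def kernelMean (P : Measure S) (h : S → S → B) : B := ∫ x, ∫ z, h x z ∂P ∂P

/-- The first Hoeffding projection of a kernel. -/
noncomputable def projLeft (P : Measure S) (h : S → S → B) (x : S) : B :=
  ∫ z, h x z ∂P - kernelMean P h

/-- The second Hoeffding projection of a kernel. -/
noncomputable def projRight (P : Measure S) (h : S → S → B) (z : S) : B :=
  ∫ x, h x z ∂P - kernelMean P h

/-- The completely degenerate part of a kernel. -/
noncomputable def residual (P : Measure S) (h : S → S → B) (x z : S) : B :=
  h x z - projLeft P h x - projRight P h z - kernelMean P h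

/-- The Hoeffding decomposition of a normalized two-sample statistic. -/
lemma rate_smul_sum_eq (P : Measure S) (h : S → S → B) {m n : ℕ} (hm : 0 < m) (hn : 0 < n)
    (ξ ζ : ℕ → S) :
    rate m n • ((m : ℝ) * n)⁻¹ •
        ∑ i ∈ Finset.range m, ∑ j ∈ Finset.range n, h (ξ i) (ζ j) =
      rate m n • kernelMean P h +
      normSum (fun x => √((n : ℝ) / ((m : ℝ) + n)) • projLeft P h x) m ξ +
      normSum (fun z => √((m : ℝ) / ((m : ℝ) + n)) • projRight P h z) n ζ +
      (rate m n * ((m : ℝ) * n)⁻¹) •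
        ∑ i ∈ Finset.range m, ∑ j ∈ Finset.range n, residual P h (ξ i) (ζ j) := by
  have hm' : (0 : ℝ) < m := by exact_mod_cast hm
  have hn' : (0 : ℝ) < n := by exact_mod_cast hn
  have hdec (i j : ℕ) : h (ξ i) (ζ j) = kernelMean P h + projLeft P h (ξ i) +
      projRight P h (ζ j) + residual P h (ξ i) (ζ j) := by
    simp only [residual]
    abel
  -- Both sides equal `√(n / (m * (m + n)))`: this is how the weights of the two normalized sums
  -- arise.
  have hA : √((n : ℝ) / ((m : ℝ) + n)) * (√(m : ℝ))⁻¹ = rate m n * (m : ℝ)⁻¹ := by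
    rw [rate, mul_div_assoc, Real.sqrt_mul hm'.le]
    field_simp
    rw [Real.sq_sqrt hm'.le]
  have hB : √((m : ℝ) / ((m : ℝ) + n)) * (√(n : ℝ))⁻¹ = rate m n * (n : ℝ)⁻¹ := by
    rw [rate, mul_comm (m : ℝ) n, mul_div_assoc, Real.sqrt_mul hn'.le]
    field_simp
    rw [Real.sq_sqrt hn'.le]
  have hsum : ∑ i ∈ Finset.range m, ∑ j ∈ Finset.range n, h (ξ i) (ζ j) =
      ((m : ℝ) * n) • kernelMean P h + (n : ℝ) • ∑ i ∈ Finset.range m, projLeft P h (ξ i) +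
      (m : ℝ) • ∑ j ∈ Finset.range n, projRight P h (ζ j) +
      ∑ i ∈ Finset.range m, ∑ j ∈ Finset.range n, residual P h (ξ i) (ζ j) := by
    simp_rw [hdec, Finset.sum_add_distrib, Finset.sum_const, Finset.card_range,
      ← Nat.cast_smul_eq_nsmul ℝ, ← Finset.smul_sum, smul_smul]
  have h1 : rate m n * (((m : ℝ) * n)⁻¹ * ((m : ℝ) * n)) = rate m n := by field_simp
  have h2 : rate m n * (((m : ℝ) * n)⁻¹ * n) = rate m n * (m : ℝ)⁻¹ := by field_simp
  have h3 : rate m n * (((m : ℝ) * n)⁻¹ * m) = rate m n * (n : ℝ)⁻¹ := by field_simp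
  simp only [normSum, ← Finset.smul_sum, smul_smul]
  rw [mul_comm (√(m : ℝ))⁻¹, mul_comm (√(n : ℝ))⁻¹, hA, hB, hsum]
  simp only [smul_add, smul_smul, mul_assoc, h1, h2, h3]

variable (P : Measure S) [IsProbabilityMeasure P] {h : S → S → B} {C : ℝ}

lemma norm_integral_le_of_bound {f : S → B} (hf : ∀ x, ‖f x‖ ≤ C) : ‖∫ x, f x ∂P‖ ≤ C := by
  simpa using norm_integral_le_of_norm_le_const (μ := P) (ae_of_all _ hf)

lemma norm_kernelMean_le (hC : ∀ x z, ‖h x z‖ ≤ C) : ‖kernelMean P h‖ ≤ C :=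
  norm_integral_le_of_bound P fun x => norm_integral_le_of_bound P (hC x)

lemma norm_projLeft_le (hC : ∀ x z, ‖h x z‖ ≤ C) (x : S) : ‖projLeft P h x‖ ≤ C + C :=
  norm_sub_le_of_le (norm_integral_le_of_bound P (hC x)) (norm_kernelMean_le P hC)

lemma norm_projRight_le (hC : ∀ x z, ‖h x z‖ ≤ C) (z : S) : ‖projRight P h z‖ ≤ C + C :=
  norm_sub_le_of_le (norm_integral_le_of_bound P fun x => hC x z) (norm_kernelMean_le P hC)

lemma norm_residual_le (hC : ∀ x z, ‖h x z‖ ≤ C) (x z : S) :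
    ‖residual P h x z‖ ≤ C + (C + C) + (C + C) + C :=
  norm_sub_le_of_le (norm_sub_le_of_le (norm_sub_le_of_le (hC x z) (norm_projLeft_le P hC x))
    (norm_projRight_le P hC z)) (norm_kernelMean_le P hC)

variable [MeasurableSpace B] [BorelSpace B] [SecondCountableTopology B]

lemma integrable_kernel {B : Type*} [NormedAddCommGroup B] [MeasurableSpace B] [BorelSpace B]
    [SecondCountableTopology B] {h : S → S → B} (hm : Measurable (Function.uncurry h)) (hC : ∀ x z, ‖h x z‖ ≤ C) :
    Integrable (Function.uncurry h) (P.prod P) :=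
  Integrable.of_bound hm.aestronglyMeasurable C (ae_of_all _ fun p => hC p.1 p.2)

lemma measurable_projLeft (hm : Measurable (Function.uncurry h)) : Measurable (projLeft P h) :=
  (hm.stronglyMeasurable.integral_prod_right (ν := P)).measurable.sub_const _

lemma measurable_projRight (hm : Measurable (Function.uncurry h)) : Measurable (projRight P h) :=
  (hm.stronglyMeasurable.integral_prod_left (μ := P)).measurable.sub_const _

lemma measurable_residual (hm : Measurable (Function.uncurry h)) :
    Measurable (Function.uncurry (residual P h)) :=
  ((hm.sub ((measurable_projLeft P hm).comp measurable_fst)).sub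
    ((measurable_projRight P hm).comp measurable_snd)).sub_const _

variable [CompleteSpace B]

lemma integral_projLeft (hm : Measurable (Function.uncurry h)) (hC : ∀ x z, ‖h x z‖ ≤ C) :
    ∫ x, projLeft P h x ∂P = 0 := by
  simp only [projLeft]
  rw [integral_sub ?_ (integrable_const _)]
  · simp [kernelMean]
  · exact (integrable_kernel P hm hC).integral_prod_left

lemma integral_projRight (hm : Measurable (Function.uncurry h)) (hC : ∀ x z, ‖h x z‖ ≤ C) :
    ∫ z, projRight P h z ∂P = 0 := by
  simp only [projRight]
  rw [integral_sub ?_ (integrable_const _)]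
  · rw [integral_integral_swap (f := fun z x => h x z) (integrable_kernel P hm hC).swap]
    simp [kernelMean]
  · exact (integrable_kernel P hm hC).integral_prod_right

/-- Degeneracy in each variable separately is what lets type 2 be applied twice to the residual sum.
-/
lemma integral_residual_left (hm : Measurable (Function.uncurry h)) (hC : ∀ x z, ‖h x z‖ ≤ C)
    (z : S) : ∫ x, residual P h x z ∂P = 0 := by
  have h1 : Integrable (fun x => h x z) P := Integrable.of_bound
    (hm.comp measurable_prodMk_right).aestronglyMeasurable C (ae_of_all _ fun x => hC x z)
  have h2 : Integrable (projLeft P h) P := Integrable.of_bound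
    (measurable_projLeft P hm).aestronglyMeasurable _ (ae_of_all _ (norm_projLeft_le P hC))
  have h3 : Integrable (fun x => h x z - projLeft P h x) P := h1.sub h2
  simp only [residual, sub_sub _ (projRight P h z)]
  rw [integral_sub h3 (integrable_const _), integral_sub h1 h2, integral_projLeft P hm hC]
  simp [projRight]

lemma integral_residual_right (hm : Measurable (Function.uncurry h)) (hC : ∀ x z, ‖h x z‖ ≤ C)
    (x : S) : ∫ z, residual P h x z ∂P = 0 := by
  have h1 : Integrable (fun z => h x z) P := Integrable.of_bound
    (hm.comp measurable_prodMk_left).aestronglyMeasurable C (ae_of_all _ fun z => hC x z)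
  have h2 : Integrable (projRight P h) P := Integrable.of_bound
    (measurable_projRight P hm).aestronglyMeasurable _ (ae_of_all _ (norm_projRight_le P hC))
  have h3 : Integrable (fun z => h x z - projRight P h z) P := h1.sub h2
  have h4 (z : S) : residual P h x z =
      h x z - projRight P h z - (projLeft P h x + kernelMean P h) := by
    simp only [residual]
    abel
  simp only [h4]
  rw [integral_sub h3 (integrable_const _), integral_sub h1 h2, integral_projRight P hm hC]
  simp [projLeft]

end Hoeffding

/-! ### Asymptotics of the rate. -/

section Rate

variable {γ : ℝ} {m n : ℕ → ℕ}

lemma tendsto_div_right (hm : Tendsto m atTop atTop)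
    (hmn : Tendsto (fun k => (m k : ℝ) / ((m k : ℝ) + n k)) atTop (𝓝 γ)) :
    Tendsto (fun k => (n k : ℝ) / ((m k : ℝ) + n k)) atTop (𝓝 (1 - γ)) := by
  refine (tendsto_const_nhds.sub hmn).congr' ?_
  filter_upwards [hm.eventually_gt_atTop 0] with k hk
  have : (0 : ℝ) < m k := by exact_mod_cast hk
  field_simp
  ring

/-- The rate tends to infinity. -/
lemma tendsto_rate_atTop (hγ : γ < 1) (hm : Tendsto m atTop atTop)
    (hmn : Tendsto (fun k => (m k : ℝ) / ((m k : ℝ) + n k)) atTop (𝓝 γ)) :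
    Tendsto (fun k => rate (m k) (n k)) atTop atTop := by
  refine Real.tendsto_sqrt_atTop.comp ?_
  simp_rw [mul_div_assoc]
  exact (tendsto_natCast_atTop_atTop.comp hm).atTop_mul_pos (sub_pos.2 hγ)
    (tendsto_div_right hm hmn)

end Rate

lemma tendstoInMeasure_comp_measurePreserving {α β B : Type*} [NormedAddCommGroup B]
    [MeasurableSpace B] [BorelSpace B] [MeasurableSpace α]
    [MeasurableSpace β] {μ : Measure α} {ν : Measure β} {π : α → β} (hπ : MeasurePreserving π μ ν)
    {f : ℕ → β → B} (hfm : ∀ k, Measurable (f k)) (hf : TendstoInMeasure ν f atTop 0) :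
    TendstoInMeasure μ (fun k x => f k (π x)) atTop 0 := by
  rw [tendstoInMeasure_iff_norm] at hf ⊢
  intro ε hε
  refine (hf ε hε).congr fun k => ?_
  have hs : MeasurableSet {y | ε ≤ ‖f k y - (0 : β → B) y‖} := by
    simpa using measurableSet_le measurable_const (hfm k).norm
  exact (hπ.measure_preimage hs.nullMeasurableSet).symm

/-! ### The two-sample limit theorem for varying kernels. -/

section TwoSample

variable {B : Type u} [NormedAddCommGroup B] [NormedSpace ℝ B]
  [MeasurableSpace B] [BorelSpace B] [SecondCountableTopology B] {S : Type u} [MeasurableSpace S]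

lemma tendstoInMeasure_normSum_of_tendsto {b : ℝ} (hb : HasTypeTwoConst B b)
    (P : Measure S) [IsProbabilityMeasure P] {U : ℕ → S → B} (hU : ∀ k, Measurable (U k)) {C : ℝ}
    (hC : ∀ k x, ‖U k x‖ ≤ C) (h0 : ∀ k, ∫ x, U k x ∂P = 0)
    (hlim : ∀ x, Tendsto (fun k => U k x) atTop (𝓝 0)) (m : ℕ → ℕ) :
    TendstoInMeasure (Measure.infinitePi fun _ : ℕ => P)
      (fun k ξ => normSum (U k) (m k) ξ) atTop 0 :=
  tendstoInMeasure_zero_of_tendsto_integral_sq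
    (fun k => integrable_norm_sq_of_bound (measurable_normSum (hU k) (m k))
      (norm_normSum_le (hC k) (m k)))
    (hb.tendsto_integral_norm_normalized_sum_sq P hU hC h0 hlim m)

variable [CompleteSpace B]

/-- The limit theorem for two independent samples of normalized sums. -/
lemma exists_tendstoInDistribution_normSum_sub {b : ℝ} (hb : HasTypeTwoConst B b)
    (P : Measure S) [IsProbabilityMeasure P] {g : S → B}
    (hg : Measurable g) {C : ℝ} (hC : ∀ x, ‖g x‖ ≤ C) (h0 : ∫ x, g x ∂P = 0)
    {α β : ℝ} (hαβ : α ^ 2 + β ^ 2 = 1) (c : B)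
    {m n : ℕ → ℕ} (hm : Tendsto m atTop atTop) (hn : Tendsto n atTop atTop) :
    ∃ G : ProbabilityMeasure B,
      (∀ L, charFunDual (G : Measure B) L =
        Complex.exp (L c * Complex.I - ((∫ x, L (g x) ^ 2 ∂P : ℝ) : ℂ) / 2)) ∧
      TendstoInDistribution (fun k (ω : (ℕ → S) × (ℕ → S)) =>
          α • normSum g (m k) ω.1 - β • normSum g (n k) ω.2 + c) atTop (id : B → B)
        (fun _ => (Measure.infinitePi fun _ : ℕ => P).prod (Measure.infinitePi fun _ : ℕ => P))
        (G : Measure B) := by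
  obtain ⟨G₀, hG₀, hlim⟩ := exists_tendsto_map_normSum hb P hg hC h0
  set ρ := Measure.infinitePi fun _ : ℕ => P with hρ
  let Λ : B × B →L[ℝ] B := α • ContinuousLinearMap.fst ℝ B B - β • ContinuousLinearMap.snd ℝ B B
  have hΛ : Continuous fun p : B × B => Λ p + c := by fun_prop
  let G : ProbabilityMeasure B := (G₀.prod G₀).map hΛ.measurable.aemeasurable
  have hGm : (G : Measure B) = (((G₀ : Measure B).prod (G₀ : Measure B)).map Λ).map (· + c) := by
    rw [Measure.map_map (by fun_prop) (by fun_prop)]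
    rfl
  refine ⟨G, fun L => ?_, ?_⟩
  · rw [hGm, charFunDual_map_add_const, charFunDual_map, charFunDual_prod, hG₀, hG₀,
      ← Complex.exp_add, ← Complex.exp_add]
    -- The exponents of the two independent limits carry `α ^ 2` and `β ^ 2`, so the sign of `β` is
    -- lost and the variances add up to that of a single sample.
    congr 1
    have h1 (x : S) : ((L.comp Λ).comp (ContinuousLinearMap.inl ℝ B B)) (g x) ^ 2 =
        α ^ 2 * L (g x) ^ 2 := by simp [Λ, mul_pow]
    have h2 (x : S) : ((L.comp Λ).comp (ContinuousLinearMap.inr ℝ B B)) (g x) ^ 2 =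
        β ^ 2 * L (g x) ^ 2 := by simp [Λ, mul_pow]
    simp only [h1, h2, integral_const_mul]
    have h3 : (α : ℂ) ^ 2 + (β : ℂ) ^ 2 = 1 := by exact_mod_cast hαβ
    push_cast
    linear_combination (-((∫ x, L (g x) ^ 2 ∂P : ℝ) : ℂ) / 2) * h3
  · have hmeas (k : ℕ) : Measurable fun ω : (ℕ → S) × (ℕ → S) =>
        (normSum g (m k) ω.1, normSum g (n k) ω.2) :=
      ((measurable_normSum hg _).comp measurable_fst).prodMk
        ((measurable_normSum hg _).comp measurable_snd)
    refine ⟨fun k => (hΛ.measurable.comp (hmeas k)).aemeasurable, aemeasurable_id, ?_⟩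
    have hprod := (ProbabilityMeasure.continuous_prod (α := B) (β := B)).continuousAt.tendsto.comp
      ((hlim.comp hm).prodMk_nhds (hlim.comp hn))
    have h := ProbabilityMeasure.tendsto_map_of_tendsto_of_continuous _ _ hprod hΛ
    have hlimit : (⟨(G : Measure B).map id, Measure.isProbabilityMeasure_map aemeasurable_id⟩ :
        ProbabilityMeasure B) = G := Subtype.ext Measure.map_id
    rw [hlimit]
    refine h.congr fun k => Subtype.ext ?_
    change ((ρ.map (normSum g (m k))).prod (ρ.map (normSum g (n k)))).map (fun p => Λ p + c) = _
    rw [Measure.map_prod_map _ _ (measurable_normSum hg _) (measurable_normSum hg _),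
      Measure.map_map hΛ.measurable (by fun_prop)]
    rfl

/-- The squared normalization is `1 / (m * n * (m + n))` against a second moment of order `m * n`.
The kernels need only a common bound, not convergence. -/
lemma tendstoInMeasure_residual {b : ℝ} (hb : HasTypeTwoConst B b)
    (P : Measure S) [IsProbabilityMeasure P] {h : ℕ → S → S → B}
    (hh : ∀ k, Measurable (Function.uncurry (h k))) {C : ℝ} (hC : ∀ k x z, ‖h k x z‖ ≤ C)
    {m n : ℕ → ℕ} (hm : Tendsto m atTop atTop) :
    TendstoInMeasure
      ((Measure.infinitePi fun _ : ℕ => P).prod (Measure.infinitePi fun _ : ℕ => P))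
      (fun k (ω : (ℕ → S) × (ℕ → S)) => (rate (m k) (n k) * ((m k : ℝ) * n k)⁻¹) •
        ∑ i ∈ Finset.range (m k), ∑ j ∈ Finset.range (n k), residual P (h k) (ω.1 i) (ω.2 j))
      atTop 0 := by
  set C' := C + (C + C) + (C + C) + C with hC'
  have hbd (k : ℕ) (x z : S) : ‖residual P (h k) x z‖ ≤ C' := norm_residual_le P (hC k) x z
  have hC'0 : 0 ≤ C' := by
    obtain ⟨x⟩ := P.nonempty_of_neZero
    exact (norm_nonneg _).trans (hbd 0 x x)
  have hmeas (k : ℕ) : Measurable fun ω : (ℕ → S) × (ℕ → S) =>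
      ∑ i ∈ Finset.range (m k), ∑ j ∈ Finset.range (n k), residual P (h k) (ω.1 i) (ω.2 j) :=
    Finset.measurable_sum _ fun i _ => Finset.measurable_sum _ fun j _ =>
      (measurable_residual P (hh k)).comp
        (by fun_prop : Measurable fun ω : (ℕ → S) × (ℕ → S) => (ω.1 i, ω.2 j))
  refine tendstoInMeasure_zero_of_tendsto_integral_sq (fun k => ?_) ?_
  · refine integrable_norm_sq_of_bound ((hmeas k).const_smul _)
      (C := ‖rate (m k) (n k) * ((m k : ℝ) * n k)⁻¹‖ * (m k * (n k * C'))) fun ω => ?_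
    rw [norm_smul]
    gcongr
    refine (norm_sum_le_of_le _ fun i _ => (norm_sum_le_of_le _ fun j _ => hbd k _ _)).trans ?_
    simp
  · have hlim : Tendsto (fun k => b ^ 2 * C' ^ 2 * (1 / (m k : ℝ))) atTop (𝓝 0) := by
      simpa using (tendsto_inv_atTop_zero.comp (tendsto_natCast_atTop_atTop.comp hm)).const_mul
        (b ^ 2 * C' ^ 2)
    refine squeeze_zero' (Eventually.of_forall fun k => integral_nonneg fun _ => by positivity)
      ?_ hlim
    filter_upwards [hm.eventually_gt_atTop 0] with k hk
    have hm0 : (0 : ℝ) < m k := by exact_mod_cast hk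
    simp_rw [norm_smul, mul_pow, integral_const_mul]
    have key := hb.integral_norm_degenerate_sum_sq_le P (measurable_residual P (hh k)) (hbd k)
      (integral_residual_left P (hh k) (hC k)) (integral_residual_right P (hh k) (hC k))
      (m k) (n k)
    refine (mul_le_mul_of_nonneg_left key (sq_nonneg _)).trans ?_
    rw [Real.norm_eq_abs, sq_abs, mul_pow, rate, Real.sq_sqrt (by positivity)]
    rcases Nat.eq_zero_or_pos (n k) with hn | hn
    · simp only [hn, Nat.cast_zero, mul_zero]
      positivity
    · have hn0 : (0 : ℝ) < n k := by exact_mod_cast hn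
      have e : (m k : ℝ) * n k / ((m k : ℝ) + n k) * (((m k : ℝ) * n k)⁻¹) ^ 2 *
          (b ^ 2 * C' ^ 2 * ((m k : ℝ) * n k)) = b ^ 2 * C' ^ 2 * (1 / ((m k : ℝ) + n k)) := by
        field_simp
      rw [e]
      gcongr
      linarith

/-- Weak convergence of normalized two-sample statistics with varying bounded kernels whose
Hoeffding projections converge to `g` and `-g`. -/
theorem exists_tendstoInDistribution_twoSample {b : ℝ} (hb : HasTypeTwoConst B b)
    (P : Measure S) [IsProbabilityMeasure P] {h : ℕ → S → S → B}
    (hh : ∀ k, Measurable (Function.uncurry (h k))) {C : ℝ} (hC : ∀ k x z, ‖h k x z‖ ≤ C)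
    {g : S → B} (hleft : ∀ x, Tendsto (fun k => projLeft P (h k) x) atTop (𝓝 (g x)))
    (hright : ∀ z, Tendsto (fun k => projRight P (h k) z) atTop (𝓝 (-g z)))
    {γ : ℝ} (hγ : γ ∈ Ioo (0 : ℝ) 1) {m n : ℕ → ℕ} (hm : Tendsto m atTop atTop)
    (hn : Tendsto n atTop atTop)
    (hmn : Tendsto (fun k => (m k : ℝ) / ((m k : ℝ) + n k)) atTop (𝓝 γ)) {c : B}
    (hc : Tendsto (fun k => rate (m k) (n k) • kernelMean P (h k)) atTop (𝓝 c)) :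
    ∃ G : ProbabilityMeasure B,
      (∀ L, charFunDual (G : Measure B) L =
        Complex.exp (L c * Complex.I - ((∫ x, L (g x) ^ 2 ∂P : ℝ) : ℂ) / 2)) ∧
      TendstoInDistribution (fun k (ω : (ℕ → S) × (ℕ → S)) =>
          rate (m k) (n k) • ((m k : ℝ) * n k)⁻¹ •
            ∑ i ∈ Finset.range (m k), ∑ j ∈ Finset.range (n k), h k (ω.1 i) (ω.2 j))
        atTop (id : B → B)
        (fun _ => (Measure.infinitePi fun _ : ℕ => P).prod (Measure.infinitePi fun _ : ℕ => P))
        (G : Measure B) := by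
  have hmeasL (k : ℕ) := measurable_projLeft P (hh k)
  have hmeasR (k : ℕ) := measurable_projRight P (hh k)
  have hbdL (k : ℕ) := norm_projLeft_le P (hC k)
  have hbdR (k : ℕ) := norm_projRight_le P (hC k)
  have hC0 : 0 ≤ C + C := by
    obtain ⟨x⟩ := P.nonempty_of_neZero
    exact (norm_nonneg _).trans (hbdL 0 x)
  have hg : Measurable g := measurable_of_tendsto_metrizable hmeasL (tendsto_pi_nhds.2 hleft)
  have hgC (x : S) : ‖g x‖ ≤ C + C :=
    le_of_tendsto (hleft x).norm (Eventually.of_forall fun k => hbdL k x)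
  have hgint : Integrable g P :=
    Integrable.of_bound hg.aestronglyMeasurable _ (ae_of_all _ hgC)
  -- The limit `g` inherits centering from the projections by dominated convergence.
  have hg0 : ∫ x, g x ∂P = 0 := by
    have h1 := tendsto_integral_of_dominated_convergence (μ := P) (fun _ => C + C)
      (fun k => (hmeasL k).aestronglyMeasurable) (integrable_const _)
      (fun k => ae_of_all _ (hbdL k)) (ae_of_all _ hleft)
    simp only [integral_projLeft P (hh _) (hC _)] at h1
    exact (tendsto_nhds_unique tendsto_const_nhds h1).symm
  have hsq : √(1 - γ) ^ 2 + √γ ^ 2 = 1 := by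
    rw [Real.sq_sqrt (by linarith [hγ.2]), Real.sq_sqrt hγ.1.le]
    ring
  obtain ⟨G, hG, hlim⟩ := exists_tendstoInDistribution_normSum_sub hb P hg hgC hg0 hsq c hm hn
  refine ⟨G, hG, ?_⟩
  set ρ := Measure.infinitePi fun _ : ℕ => P with hρ
  -- the coefficients of the two projections and their limits
  let p (k : ℕ) : ℝ := √((n k : ℝ) / ((m k : ℝ) + n k))
  let q (k : ℕ) : ℝ := √((m k : ℝ) / ((m k : ℝ) + n k))
  have hp : Tendsto p atTop (𝓝 √(1 - γ)) := (tendsto_div_right hm hmn).sqrt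
  have hq : Tendsto q atTop (𝓝 √γ) := hmn.sqrt
  have hp1 (k : ℕ) : ‖p k‖ ≤ 1 := by
    rw [Real.norm_of_nonneg (Real.sqrt_nonneg _)]
    exact Real.sqrt_le_one.2 (div_le_one_of_le₀ (by simp) (by positivity))
  have hq1 (k : ℕ) : ‖q k‖ ≤ 1 := by
    rw [Real.norm_of_nonneg (Real.sqrt_nonneg _)]
    exact Real.sqrt_le_one.2 (div_le_one_of_le₀ (by simp) (by positivity))
  have hγ1 : ‖√(1 - γ)‖ ≤ 1 := by
    rw [Real.norm_of_nonneg (Real.sqrt_nonneg _)]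
    exact Real.sqrt_le_one.2 (by linarith [hγ.1])
  have hγ2 : ‖√γ‖ ≤ 1 := by
    rw [Real.norm_of_nonneg (Real.sqrt_nonneg _)]
    exact Real.sqrt_le_one.2 hγ.2.le
  have hsmul {a : ℝ} {v : B} (ha : ‖a‖ ≤ 1) (hv : ‖v‖ ≤ C + C) : ‖a • v‖ ≤ C + C := by
    rw [norm_smul]
    exact (mul_le_of_le_one_left (norm_nonneg _) ha).trans hv
  -- `U` and `V` are the errors of replacing the weighted projections by their limits: bounded,
  -- centered and pointwise null. The plus sign in `V` reflects the limit `-g`.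
  let U (k : ℕ) (x : S) : B := p k • projLeft P (h k) x - √(1 - γ) • g x
  let V (k : ℕ) (z : S) : B := q k • projRight P (h k) z + √γ • g z
  have hU (k : ℕ) : Measurable (U k) := ((hmeasL k).const_smul _).sub (hg.const_smul _)
  have hV (k : ℕ) : Measurable (V k) := ((hmeasR k).const_smul _).add (hg.const_smul _)
  have hUlim := tendstoInMeasure_normSum_of_tendsto hb P hU (C := C + C + (C + C))
    (fun k x => norm_sub_le_of_le (hsmul (hp1 k) (hbdL k x)) (hsmul hγ1 (hgC x)))
    (fun k => by
      have h1 : Integrable (projLeft P (h k)) P :=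
        Integrable.of_bound (hmeasL k).aestronglyMeasurable _ (ae_of_all _ (hbdL k))
      have h2 : Integrable (fun x => p k • projLeft P (h k) x) P := h1.smul _
      have h3 : Integrable (fun x => √(1 - γ) • g x) P := hgint.smul _
      simp only [U]
      rw [integral_sub h2 h3, integral_smul, integral_smul,
        integral_projLeft P (hh k) (hC k), hg0]
      simp)
    (fun x => by simpa using (hp.smul (hleft x)).sub_const (√(1 - γ) • g x)) m
  have hVlim := tendstoInMeasure_normSum_of_tendsto hb P hV (C := C + C + (C + C))
    (fun k x => norm_add_le_of_le (hsmul (hq1 k) (hbdR k x)) (hsmul hγ2 (hgC x)))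
    (fun k => by
      have h1 : Integrable (projRight P (h k)) P :=
        Integrable.of_bound (hmeasR k).aestronglyMeasurable _ (ae_of_all _ (hbdR k))
      have h2 : Integrable (fun x => q k • projRight P (h k) x) P := h1.smul _
      have h3 : Integrable (fun x => √γ • g x) P := hgint.smul _
      simp only [V]
      rw [integral_add h2 h3, integral_smul, integral_smul,
        integral_projRight P (hh k) (hC k), hg0]
      simp)
    (fun x => by simpa using (hq.smul (hright x)).add_const (√γ • g x)) n
  have hUlim' := tendstoInMeasure_comp_measurePreserving
    (measurePreserving_fst (μ := ρ) (ν := ρ)) (fun k => measurable_normSum (hU k) (m k)) hUlim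
  have hVlim' := tendstoInMeasure_comp_measurePreserving
    (measurePreserving_snd (μ := ρ) (ν := ρ)) (fun k => measurable_normSum (hV k) (n k)) hVlim
  have hconst : TendstoInMeasure (ρ.prod ρ)
      (fun k (_ : (ℕ → S) × (ℕ → S)) => rate (m k) (n k) • kernelMean P (h k) - c) atTop 0 :=
    tendstoInMeasure_of_tendsto_ae (fun k => aestronglyMeasurable_const)
      (ae_of_all _ fun ω => by simpa using hc.sub_const c)
  have hsum := tendstoInMeasure_zero_add (tendstoInMeasure_zero_add (tendstoInMeasure_zero_add
    hconst hUlim') hVlim') (tendstoInMeasure_residual hb P hh hC (n := n) hm)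
  -- Slutsky's theorem; the decomposition needs both samples nonempty, which holds eventually.
  refine tendstoInDistribution_of_tendstoInMeasure_sub _ _ hlim ?_ fun k => ?_
  · rw [tendstoInMeasure_iff_norm] at hsum ⊢
    intro ε hε
    refine (hsum ε hε).congr' ?_
    filter_upwards [hm.eventually_gt_atTop 0, hn.eventually_gt_atTop 0] with k hmk hnk
    congr 1
    ext ω
    simp only [mem_ofPred_eq, Pi.zero_apply, sub_zero, Pi.sub_apply]
    rw [rate_smul_sum_eq P (h k) hmk hnk]
    have e1 : normSum (U k) (m k) ω.1 =
        normSum (fun x => p k • projLeft P (h k) x) (m k) ω.1 -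
          √(1 - γ) • normSum g (m k) ω.1 := by
      simp only [normSum, U, Finset.sum_sub_distrib, smul_sub, ← Finset.smul_sum]
      rw [smul_comm √(1 - γ)]
    have e2 : normSum (V k) (n k) ω.2 =
        normSum (fun x => q k • projRight P (h k) x) (n k) ω.2 +
          √γ • normSum g (n k) ω.2 := by
      simp only [normSum, V, Finset.sum_add_distrib, smul_add, ← Finset.smul_sum]
      rw [smul_comm √γ]
    rw [e1, e2]
    refine iff_of_eq (congrArg (fun v : B => ε ≤ ‖v‖) ?_)
    simp only [p, q]
    abel
  · refine Measurable.aemeasurable (((Finset.measurable_sum _ fun i _ =>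
      Finset.measurable_sum _ fun j _ => (hh k).comp
        (by fun_prop : Measurable fun ω : (ℕ → S) × (ℕ → S) => (ω.1 i, ω.2 j))).const_smul
          _).const_smul _)

end TwoSample

/-! ### Identifying the Gaussian limit. -/

section Gaussian

variable {B : Type*} [NormedAddCommGroup B] [NormedSpace ℝ B]
  [MeasurableSpace B] [BorelSpace B] {S : Type*} [MeasurableSpace S]

/-- A probability measure with a Gaussian characteristic function is Gaussian, with the expected
mean and covariance. -/
lemma isGaussianWith_of_charFunDual_eq {G : Measure B} [IsProbabilityMeasure G]
    (P : Measure S) [IsProbabilityMeasure P] {g : S → B} (hg : Measurable g) {C : ℝ}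
    (hC : ∀ x, ‖g x‖ ≤ C) {c : B}
    (hG : ∀ L, charFunDual G L =
      Complex.exp (L c * Complex.I - ((∫ x, L (g x) ^ 2 ∂P : ℝ) : ℂ) / 2)) :
    IsGaussianWith G c fun L L' => ∫ x, L (g x) * L' (g x) ∂P := by
  have hnn (L : StrongDual ℝ B) : 0 ≤ ∫ x, L (g x) ^ 2 ∂P := integral_nonneg fun x => sq_nonneg _
  have hmap (L : StrongDual ℝ B) :
      G.map L = gaussianReal (L c) (∫ x, L (g x) ^ 2 ∂P).toNNReal := by
    have : IsProbabilityMeasure (G.map L) := Measure.isProbabilityMeasure_map (by fun_prop)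
    refine Measure.ext_of_charFun (funext fun t => ?_)
    rw [charFun_map_eq_charFunDual_smul, hG, charFun_gaussianReal, Real.coe_toNNReal _ (hnn L)]
    congr 1
    have h1 : ∫ x, (t • L) (g x) ^ 2 ∂P = t ^ 2 * ∫ x, L (g x) ^ 2 ∂P := by
      rw [← integral_const_mul]
      simp [mul_pow]
    rw [h1]
    simp only [_root_.smul_apply, smul_eq_mul]
    push_cast
    ring
  have hgauss : IsGaussian G := isGaussian_of_map_eq_gaussianReal fun L => ⟨_, _, hmap L⟩
  have hmean (L : StrongDual ℝ B) : ∫ w, L w ∂G = L c := by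
    have h := integral_map (μ := G) (φ := L) (f := id) (by fun_prop)
      measurable_id.aestronglyMeasurable
    rw [hmap L] at h
    simpa using h.symm
  have hvar (L : StrongDual ℝ B) : Var[fun w => L w; G] = ∫ x, L (g x) ^ 2 ∂P := by
    have h := variance_map (μ := G) (Y := L) (X := id) measurable_id.aemeasurable (by fun_prop)
    rw [hmap L, variance_id_gaussianReal, Real.coe_toNNReal _ (hnn L)] at h
    exact h.symm
  refine ⟨hgauss, hmean, fun L L' => ?_⟩
  have hL2 (L : StrongDual ℝ B) : MemLp (fun w => L w) 2 G :=
    IsGaussian.memLp_dual G L 2 (by simp)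
  -- Polarization: the covariance is read off from the variances of `L`, `L'` and `L + L'`.
  have hadd := variance_fun_add (hL2 L) (hL2 L')
  have hvadd : Var[fun w => L w + L' w; G] = ∫ x, (L + L') (g x) ^ 2 ∂P := hvar (L + L')
  rw [hvadd, hvar, hvar] at hadd
  have hbd (L L' : StrongDual ℝ B) : Integrable (fun x => L (g x) * L' (g x)) P := by
    refine Integrable.of_bound (by fun_prop) ((‖L‖ * C) * (‖L'‖ * C)) (ae_of_all _ fun x => ?_)
    rw [norm_mul]
    have h1 : ‖L (g x)‖ ≤ ‖L‖ * C := (L.le_opNorm _).trans (by gcongr; exact hC x)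
    have h2 : ‖L' (g x)‖ ≤ ‖L'‖ * C := (L'.le_opNorm _).trans (by gcongr; exact hC x)
    exact mul_le_mul h1 h2 (norm_nonneg _) ((norm_nonneg _).trans h1)
  have hexp : ∫ x, (L + L') (g x) ^ 2 ∂P = ∫ x, L (g x) ^ 2 ∂P +
      2 * ∫ x, L (g x) * L' (g x) ∂P + ∫ x, L' (g x) ^ 2 ∂P := by
    have e1 : Integrable (fun x => L (g x) ^ 2) P := by simpa [sq] using hbd L L
    have e2 : Integrable (fun x => L' (g x) ^ 2) P := by simpa [sq] using hbd L' L'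
    have e3 : Integrable (fun x => 2 * (L (g x) * L' (g x))) P := (hbd L L').const_mul 2
    have e4 : Integrable (fun x => L (g x) ^ 2 + 2 * (L (g x) * L' (g x))) P := e1.add e3
    rw [← integral_const_mul, ← integral_add e1 e3, ← integral_add e4 e2]
    refine integral_congr_ae (ae_of_all _ fun x => ?_)
    simp only [_root_.add_apply]
    ring
  linarith

end Gaussian

/-! ### The shifted sign kernel and its projections. -/

section SignKernel

variable {E : Type u} [NormedAddCommGroup E] [NormedSpace ℝ E]

/-- The kernel `(x, z) ↦ SGN_{z - x + v}`. -/
noncomputable def signKernel (v : E) (x z : E) : StrongDual ℝ E := SGN (z - x + v)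

lemma norm_signKernel_le (v x z : E) : ‖signKernel v x z‖ ≤ 1 := norm_SGN_le _

variable [MeasurableSpace E] [BorelSpace E] [SecondCountableTopology E]
  [SecondCountableTopology (StrongDual ℝ E)]
  (hnorm : ∀ x : E, x ≠ 0 → TwiceGateauxDifferentiableAt (fun y : E => ‖y‖) x)
  (P : Measure E) [IsProbabilityMeasure P]

include hnorm

lemma measurable_signKernel (v : E) : Measurable (Function.uncurry (signKernel v)) :=
  (measurable_SGN hnorm).comp ((measurable_snd.sub measurable_fst).add_const v)

lemma kernelMean_signKernel (v : E) : kernelMean P (signKernel v) = meanSGN P P v :=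
  (integral_prod _ (integrable_kernel P (measurable_signKernel hnorm v)
    (norm_signKernel_le v))).symm

/-- Exchanging the two i.i.d. variables changes the sign of the kernel, so the mean equals its own
negative. -/
lemma kernelMean_signKernel_zero : kernelMean P (signKernel (0 : E)) = 0 := by
  have h : kernelMean P (signKernel (0 : E)) = -kernelMean P (signKernel (0 : E)) := by
    conv_lhs => rw [kernelMean]
    rw [integral_integral_swap (integrable_kernel P (measurable_signKernel hnorm 0)
      (norm_signKernel_le 0)), kernelMean, ← integral_neg]
    refine integral_congr_ae (ae_of_all _ fun x => ?_)
    dsimp only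
    rw [← integral_neg]
    refine integral_congr_ae (ae_of_all _ fun z => ?_)
    simp only [signKernel, add_zero]
    rw [← SGN_neg hnorm, neg_sub]
  have h2 : (2 : ℝ) • kernelMean P (signKernel (0 : E)) = 0 := by
    rw [two_smul]
    nth_rewrite 2 [h]
    exact add_neg_cancel _
  exact (smul_eq_zero.1 h2).resolve_left two_ne_zero

lemma projRight_signKernel_zero (z : E) :
    projRight P (signKernel (0 : E)) z = -projLeft P (signKernel (0 : E)) z := by
  simp only [projRight, projLeft, kernelMean_signKernel_zero hnorm P, sub_zero]
  rw [← integral_neg]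
  refine integral_congr_ae (ae_of_all _ fun x => ?_)
  simp only [signKernel, add_zero]
  rw [← SGN_neg hnorm, neg_sub]

variable [CompleteSpace E] (hP : ∀ x : E, P {x} = 0) (δ : E) {t : ℕ → ℝ}
  (ht : Tendsto t atTop (𝓝 0)) (htne : ∀ᶠ k in atTop, t k ≠ 0)

include hP ht htne

/-- Continuity along lines may fail only at `z = x`, a null set because `P` has no atoms. The limit
therefore holds for every `x`. -/
lemma tendsto_integral_signKernel_right (x : E) :
    Tendsto (fun k => ∫ z, signKernel (t k • δ) x z ∂P) atTop
      (𝓝 (∫ z, signKernel (0 : E) x z ∂P)) := by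
  refine tendsto_integral_of_dominated_convergence (fun _ => 1) (fun k =>
    ((measurable_signKernel hnorm _).comp measurable_prodMk_left).aestronglyMeasurable)
    (integrable_const _) (fun k => ae_of_all _ fun z => norm_signKernel_le _ _ _) ?_
  have hne : ∀ᵐ z ∂P, z ≠ x := by simpa [ae_iff] using hP x
  filter_upwards [hne] with z hz
  simpa [signKernel] using tendsto_SGN_add_smul hnorm (sub_ne_zero.2 hz) δ ht htne

lemma tendsto_integral_signKernel_left (z : E) :
    Tendsto (fun k => ∫ x, signKernel (t k • δ) x z ∂P) atTop
      (𝓝 (∫ x, signKernel (0 : E) x z ∂P)) := by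
  refine tendsto_integral_of_dominated_convergence (fun _ => 1) (fun k =>
    ((measurable_signKernel hnorm _).comp measurable_prodMk_right).aestronglyMeasurable)
    (integrable_const _) (fun k => ae_of_all _ fun x => norm_signKernel_le _ _ _) ?_
  have hne : ∀ᵐ x ∂P, x ≠ z := by simpa [ae_iff] using hP z
  filter_upwards [hne] with x hx
  simpa [signKernel] using tendsto_SGN_add_smul hnorm (sub_ne_zero.2 hx.symm) δ ht htne

lemma tendsto_kernelMean_signKernel :
    Tendsto (fun k => kernelMean P (signKernel (t k • δ))) atTop
      (𝓝 (kernelMean P (signKernel (0 : E)))) := by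
  refine tendsto_integral_of_dominated_convergence (fun _ => 1) (fun k =>
    (measurable_signKernel hnorm _).stronglyMeasurable.integral_prod_right.aestronglyMeasurable)
    (integrable_const _)
    (fun k => ae_of_all _ fun x => norm_integral_le_of_bound P (norm_signKernel_le _ x)) ?_
  exact ae_of_all _ (tendsto_integral_signKernel_right hnorm P hP δ ht htne)

lemma tendsto_projLeft_signKernel (x : E) :
    Tendsto (fun k => projLeft P (signKernel (t k • δ)) x) atTop
      (𝓝 (projLeft P (signKernel (0 : E)) x)) :=
  (tendsto_integral_signKernel_right hnorm P hP δ ht htne x).sub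
    (tendsto_kernelMean_signKernel hnorm P hP δ ht htne)

lemma tendsto_projRight_signKernel (z : E) :
    Tendsto (fun k => projRight P (signKernel (t k • δ)) z) atTop
      (𝓝 (-projLeft P (signKernel (0 : E)) z)) := by
  rw [← projRight_signKernel_zero hnorm P]
  exact (tendsto_integral_signKernel_left hnorm P hP δ ht htne z).sub
    (tendsto_kernelMean_signKernel hnorm P hP δ ht htne)

end SignKernel

/-! ### The covariance `Γ₁` in terms of the first projection. -/

section Covariance

variable {E : Type u} [NormedAddCommGroup E] [NormedSpace ℝ E] [MeasurableSpace E] [BorelSpace E]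
  [SecondCountableTopology E] [SecondCountableTopology (StrongDual ℝ E)]

/-- By independence, conditioning on the first coordinate means integrating out the second; no
centering term appears since the mean is `0`. -/
lemma condSGN_ae_eq
    (hnorm : ∀ x : E, x ≠ 0 → TwiceGateauxDifferentiableAt (fun y : E => ‖y‖) x)
    (P : Measure E) [IsProbabilityMeasure P] :
    condSGN P P =ᵐ[P.prod P] fun p => projLeft P (signKernel (0 : E)) p.1 := by
  have hm := measurable_projLeft P (measurable_signKernel hnorm 0)
  have hle : MeasurableSpace.comap (Prod.fst : E × E → E) inferInstance ≤
      (inferInstance : MeasurableSpace (E × E)) := measurable_fst.comap_le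
  have hint : Integrable (fun p : E × E => SGN (p.2 - p.1)) (P.prod P) := by
    have := integrable_kernel P (measurable_signKernel hnorm 0) (norm_signKernel_le 0)
    simpa [Function.uncurry_def, signKernel] using this
  have hgint : Integrable (fun p : E × E => projLeft P (signKernel (0 : E)) p.1) (P.prod P) :=
    Integrable.of_bound (hm.comp measurable_fst).aestronglyMeasurable _
      (ae_of_all _ fun p => norm_projLeft_le P (norm_signKernel_le 0) p.1)
  refine (ae_eq_condExp_of_forall_setIntegral_eq hle hint (fun s _ _ => hgint.integrableOn)
    ?_ ?_).symm
  · rintro _ ⟨A, hA, rfl⟩ -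
    have hs : (Prod.fst : E × E → E) ⁻¹' A = A ×ˢ univ := by ext; simp
    rw [hs, setIntegral_prod _ hgint.integrableOn, setIntegral_prod _ hint.integrableOn]
    refine integral_congr_ae (ae_of_all _ fun x => ?_)
    simp [projLeft, kernelMean_signKernel_zero hnorm P, signKernel]
  · refine StronglyMeasurable.aestronglyMeasurable ?_
    exact hm.stronglyMeasurable.comp_measurable (comap_measurable _)

lemma Gamma₁_eq
    (hnorm : ∀ x : E, x ≠ 0 → TwiceGateauxDifferentiableAt (fun y : E => ‖y‖) x)
    (P : Measure E) [IsProbabilityMeasure P] :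
    Gamma₁ P P = fun f f' => ∫ x, f (projLeft P (signKernel (0 : E)) x) *
      f' (projLeft P (signKernel (0 : E)) x) ∂P := by
  ext f f'
  rw [Gamma₁, ← kernelMean_signKernel hnorm P, kernelMean_signKernel_zero hnorm P, map_zero,
    zero_mul, sub_zero]
  have h : (fun p => f (condSGN P P p) * f' (condSGN P P p)) =ᵐ[P.prod P]
      fun p => f (projLeft P (signKernel (0 : E)) p.1) *
        f' (projLeft P (signKernel (0 : E)) p.1) := by
    filter_upwards [condSGN_ae_eq hnorm P] with p hp
    rw [hp]
  rw [integral_congr_ae h, integral_fun_fst (fun x => f (projLeft P (signKernel (0 : E)) x) *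
        f' (projLeft P (signKernel (0 : E)) x))]
  simp

end Covariance

/-! ### Joint laws of the samples and transfer between probability spaces. -/

section Transport

variable {S : Type*} [MeasurableSpace S]

/-- The joint law of two independent samples is the product of the two product measures. -/
lemma map_prodMk_eq_prod_pi {Ω : Type*} [MeasurableSpace Ω] {μ : Measure Ω}
    [IsProbabilityMeasure μ] {m n : ℕ} {X : Fin m → Ω → S} {Y : Fin n → Ω → S}
    (hindep : iIndepFun (Sum.elim X Y) μ) {P Q : Measure S} [IsProbabilityMeasure P]
    [IsProbabilityMeasure Q] (hX : ∀ i, HasLaw (X i) P μ) (hY : ∀ j, HasLaw (Y j) Q μ) :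
    μ.map (fun ω => (fun i => X i ω, fun j => Y j ω)) =
      (Measure.pi fun _ : Fin m => P).prod (Measure.pi fun _ : Fin n => Q) := by
  let M : Fin m ⊕ Fin n → Measure S := Sum.elim (fun _ => P) (fun _ => Q)
  have hM : ∀ s, IsProbabilityMeasure (M s) := by
    rintro (i | j)
    · exact ‹IsProbabilityMeasure P›
    · exact ‹IsProbabilityMeasure Q›
  have hae : ∀ s, AEMeasurable (Sum.elim X Y s) μ := by
    rintro (i | j)
    · exact (hX i).aemeasurable
    · exact (hY j).aemeasurable
  have hmap : ∀ s, μ.map (Sum.elim X Y s) = M s := by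
    rintro (i | j)
    · exact (hX i).map_eq
    · exact (hY j).map_eq
  have h1 : μ.map (fun ω s => Sum.elim X Y s ω) = Measure.pi M := by
    rw [hindep.map_fun_eq_pi_map hae]
    simp only [hmap]
  have h2 := (measurePreserving_sumPiEquivProdPi M).map_eq
  rw [← h1, AEMeasurable.map_map_of_aemeasurable
    (MeasurableEquiv.measurable _).aemeasurable (aemeasurable_pi_iff.2 hae)] at h2
  exact h2

/-- Finite samples are realized as initial segments of one infinite sequence; taking `f` to be a
translation produces the shifted sample. -/
lemma infinitePi_map_comp_fin (P : Measure S) [IsProbabilityMeasure P] {f : S → S}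
    (hf : Measurable f) (m : ℕ) :
    (Measure.infinitePi fun _ : ℕ => P).map (fun ξ (i : Fin m) => f (ξ i)) =
      Measure.pi fun _ : Fin m => P.map f := by
  have hind : iIndepFun (fun (i : Fin m) (ξ : ℕ → S) => f (ξ i))
      (Measure.infinitePi fun _ : ℕ => P) :=
    (iIndepFun_infinitePi (P := fun _ : ℕ => P) (X := fun _ => f) fun _ => hf).precomp
      Fin.val_injective
  refine (hind.map_fun_eq_pi_map
    fun i => (hf.comp (measurable_pi_apply _)).aemeasurable).trans ?_
  congr 1
  ext1 i
  change Measure.map (f ∘ fun ξ : ℕ → S => ξ i) _ = _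
  rw [← Measure.map_map hf (measurable_pi_apply _), Measure.infinitePi_map_eval]

/-- Convergence in distribution depends on the laws only. -/
lemma tendstoInDistribution_of_map_eq {E Ω' Ω'' : Type*} [TopologicalSpace E] [MeasurableSpace E]
    [OpensMeasurableSpace E] {Ω : ℕ → Type*} [∀ k, MeasurableSpace (Ω k)]
    {μ : (k : ℕ) → Measure (Ω k)} [∀ k, IsProbabilityMeasure (μ k)]
    [MeasurableSpace Ω'] {ν : Measure Ω'} [IsProbabilityMeasure ν]
    [MeasurableSpace Ω''] {κ : Measure Ω''} [IsProbabilityMeasure κ]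
    {X : (k : ℕ) → Ω k → E} {X' : ℕ → Ω' → E} {Z : Ω'' → E}
    (h : TendstoInDistribution X' atTop Z (fun _ => ν) κ) (hX : ∀ k, AEMeasurable (X k) (μ k))
    (heq : ∀ k, (μ k).map (X k) = ν.map (X' k)) : TendstoInDistribution X atTop Z μ κ where
  forall_aemeasurable := hX
  aemeasurable_limit := h.aemeasurable_limit
  tendsto := h.tendsto.congr fun k => Subtype.ext (heq k).symm

end Transport

section Statistic

variable {E : Type u} [NormedAddCommGroup E] [NormedSpace ℝ E] [MeasurableSpace E] [BorelSpace E]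
  [SecondCountableTopology E] [SecondCountableTopology (StrongDual ℝ E)]

lemma measurable_smul_statistic
    (hnorm : ∀ x : E, x ≠ 0 → TwiceGateauxDifferentiableAt (fun y : E => ‖y‖) x) (m n : ℕ) (a : ℝ) :
    Measurable fun p : (Fin m → E) × (Fin n → E) => a • statistic p.1 p.2 := by
  have hsum : Measurable fun p : (Fin m → E) × (Fin n → E) => ∑ i, ∑ j, SGN (p.2 j - p.1 i) :=
    Finset.measurable_sum _ fun i _ => Finset.measurable_sum _ fun j _ =>
      (measurable_SGN hnorm).comp (by fun_prop)
  have h1 : Measurable fun p : (Fin m → E) × (Fin n → E) =>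
      ((m : ℝ) * n)⁻¹ • ∑ i, ∑ j, SGN (p.2 j - p.1 i) := hsum.const_smul ((m : ℝ) * n)⁻¹
  exact h1.const_smul a

end Statistic

end WMW

/-! ### The main theorem. -/

theorem theorem2
    {𝒳 : Type*} [NormedAddCommGroup 𝒳] [NormedSpace ℝ 𝒳] [CompleteSpace 𝒳]
    [MeasurableSpace 𝒳] [BorelSpace 𝒳]
    [TopologicalSpace.SeparableSpace (StrongDual ℝ 𝒳)]
    (htype : WMW.IsTypeTwo (StrongDual ℝ 𝒳))
    (hnorm : ∀ x : 𝒳, x ≠ 0 → WMW.TwiceGateauxDifferentiableAt (fun y : 𝒳 => ‖y‖) x)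
    (P : Measure 𝒳) [IsProbabilityMeasure P] (hP : ∀ x : 𝒳, P {x} = 0)
    (J₀ : 𝒳 → StrongDual ℝ 𝒳) (hJ₀ : WMW.IsHessianAt P P J₀ 0)
    (δ : 𝒳) (hδ : δ ≠ 0)
    (γ : ℝ) (hγ : γ ∈ Ioo (0 : ℝ) 1)
    (m n : ℕ → ℕ) (hm : Tendsto m atTop atTop) (hn : Tendsto n atTop atTop)
    (hmn : Tendsto (fun k => (m k : ℝ) / ((m k : ℝ) + n k)) atTop (𝓝 γ))
    (Ω : ℕ → Type*) [∀ k, MeasurableSpace (Ω k)]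
    (μ : (k : ℕ) → Measure (Ω k)) [∀ k, IsProbabilityMeasure (μ k)]
    (X : (k : ℕ) → Fin (m k) → Ω k → 𝒳) (Y : (k : ℕ) → Fin (n k) → Ω k → 𝒳)
    (hindep : ∀ k, iIndepFun (Sum.elim (X k) (Y k)) (μ k))
    (hX : ∀ k i, HasLaw (X k i) P (μ k))
    (hY : ∀ k j, HasLaw (Y k j) (P.map (fun x => x + (WMW.rate (m k) (n k))⁻¹ • δ)) (μ k)) :
    ∃ G : ProbabilityMeasure (StrongDual ℝ 𝒳),
      WMW.IsGaussianWith (G : Measure (StrongDual ℝ 𝒳)) (J₀ δ) (WMW.Gamma₁ P P) ∧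
      TendstoInDistribution
        (fun k ω => WMW.rate (m k) (n k) •
          WMW.statistic (fun i => X k i ω) (fun j => Y k j ω))
        atTop (id : StrongDual ℝ 𝒳 → StrongDual ℝ 𝒳) μ (G : Measure (StrongDual ℝ 𝒳)) := by
  have hsep : TopologicalSpace.SeparableSpace 𝒳 := WMW.separableSpace_of_separableSpace_strongDual
  have hsc : SecondCountableTopology 𝒳 := UniformSpace.secondCountable_of_separable 𝒳
  have hsc' : SecondCountableTopology (StrongDual ℝ 𝒳) :=
    UniformSpace.secondCountable_of_separable _
  obtain ⟨b, hb⟩ : ∃ b : ℝ, WMW.HasTypeTwoConst (StrongDual ℝ 𝒳) b := htype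
  have hrate := WMW.tendsto_rate_atTop hγ.2 hm hmn
  let t (k : ℕ) : ℝ := (WMW.rate (m k) (n k))⁻¹
  have ht : Tendsto t atTop (𝓝 0) := tendsto_inv_atTop_zero.comp hrate
  have htne : ∀ᶠ k in atTop, t k ≠ 0 := by
    filter_upwards [hrate.eventually_gt_atTop 0] with k hk using inv_ne_zero hk.ne'
  -- With step `t k = rate⁻¹` and zero mean at the origin, this is the difference quotient defining
  -- `J₀ δ`.
  have hmean : Tendsto (fun k => WMW.rate (m k) (n k) •
      WMW.kernelMean P (WMW.signKernel (t k • δ))) atTop (𝓝 (J₀ δ)) := by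
    have h := (hJ₀ δ).tendsto_slope_zero.comp (tendsto_nhdsWithin_iff.2 ⟨ht, htne⟩)
    refine h.congr fun k => ?_
    simp only [Function.comp_apply, zero_add]
    rw [← WMW.kernelMean_signKernel hnorm P, ← WMW.kernelMean_signKernel hnorm P,
      WMW.kernelMean_signKernel_zero hnorm P, sub_zero, inv_inv]
  obtain ⟨G, hG, hlim⟩ := WMW.exists_tendstoInDistribution_twoSample hb P
    (h := fun k => WMW.signKernel (t k • δ)) (fun k => WMW.measurable_signKernel hnorm _)
    (fun k => WMW.norm_signKernel_le _) (WMW.tendsto_projLeft_signKernel hnorm P hP δ ht htne)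
    (WMW.tendsto_projRight_signKernel hnorm P hP δ ht htne) hγ hm hn hmn hmean
  refine ⟨G, ?_, ?_⟩
  · rw [WMW.Gamma₁_eq hnorm P]
    exact WMW.isGaussianWith_of_charFunDual_eq P
      (WMW.measurable_projLeft P (WMW.measurable_signKernel hnorm 0))
      (WMW.norm_projLeft_le P (WMW.norm_signKernel_le 0)) hG
  · have hF (k : ℕ) := WMW.measurable_smul_statistic hnorm (m k) (n k) (WMW.rate (m k) (n k))
    have hshift (k : ℕ) : Measurable fun x : 𝒳 => x + t k • δ := by fun_prop
    have hXY (k : ℕ) : AEMeasurable (fun ω => (fun i => X k i ω, fun j => Y k j ω)) (μ k) :=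
      (aemeasurable_pi_iff.2 fun i => (hX k i).aemeasurable).prodMk
        (aemeasurable_pi_iff.2 fun j => (hY k j).aemeasurable)
    have hFXY (k : ℕ) : AEMeasurable (fun ω => WMW.rate (m k) (n k) •
        WMW.statistic (fun i => X k i ω) (fun j => Y k j ω)) (μ k) := by
      have h := (hF k).comp_aemeasurable (hXY k)
      exact h
    refine WMW.tendstoInDistribution_of_map_eq hlim hFXY fun k => ?_
    have hPs : IsProbabilityMeasure (P.map fun x => x + t k • δ) :=
      Measure.isProbabilityMeasure_map (hshift k).aemeasurable
    have h1 := WMW.map_prodMk_eq_prod_pi (hindep k) (hX k) (hY k)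
    -- The given samples have the law of two i.i.d. sequences with the second translated; the
    -- translation is then absorbed into the kernel through `y + t k • δ - x = y - x + t k • δ`.
    have h2 : ((Measure.infinitePi fun _ : ℕ => P).prod (Measure.infinitePi fun _ : ℕ => P)).map
        (Prod.map (fun ξ (i : Fin (m k)) => id (ξ i))
          (fun ζ (j : Fin (n k)) => ζ j + t k • δ)) =
        (Measure.pi fun _ : Fin (m k) => P).prod
          (Measure.pi fun _ : Fin (n k) => P.map fun x => x + t k • δ) := by
      rw [← Measure.map_prod_map _ _ (by fun_prop) (by fun_prop),
        WMW.infinitePi_map_comp_fin P measurable_id, WMW.infinitePi_map_comp_fin P (hshift k),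
        Measure.map_id]
    have h3 := AEMeasurable.map_map_of_aemeasurable (hF k).aemeasurable (hXY k)
    refine Eq.trans h3.symm ?_
    rw [h1, ← h2, Measure.map_map (hF k) (by fun_prop)]
    congr 1
    ext1 ω
    simp only [Function.comp_apply, WMW.statistic, Prod.map, id, Finset.sum_range,
      WMW.signKernel, add_sub_right_comm]
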